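/- Let $d\ge 1$ and $\nu>\frac d2$. On $\mathbb Z^d\subset\mathbb R^d$ let $|x|$ be the Euclidean norm, $\|x\|=\max_j|x_j|$ and $\langle x\rangle=\sqrt{1+\|x\|^2}$; for $x\in\mathbb R^d$, $L>0$ let $\Lambda_L(x)=\{y\in\mathbb Z^d:\|y-x\|\le \frac L2\}$. **Exponents.** Fix $0<\xi<\zeta<1$ and $\tau,\beta\in(0,1)$, $\gamma>1$, $\kappa\in(0,1)$, $\kappa'\in[0,1)$ with $$\zeta<\beta<\tfrac1\gamma<1<\gamma<\sqrt{\zeta/\xi},\qquad \max\{\gamma\beta,\tfrac{(\gamma-1)\beta+1}{\gamma}\}<\tau<1,\qquad \kappa+\kappa'<\tau-\gamma\beta,$$ and set $\varrho=\min\{\kappa,\frac{1-\tau}2,\gamma\tau-(\gamma-1)\frac{\zeta+\beta}2-1\}$. **Model.** $H_{\boldsymbol\omega}=-\Delta+V_{\boldsymbol\omega}$ on $\ell^2(\mathbb Z^d)$, where $(\Delta\varphi)(x)=\sum_{|y-x|=1}\varphi(y)$, $V_{\boldsymbol\omega}(x)=\omega_x$, and $\{\omega_x\}_{x\in\mathbb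 Z^d}$ are i.i.d. real random variables whose law $\mu$ has bounded support and satisfies, for some $\alpha\in(0,1]$ and some constant $K$, $\sup_{a\in\mathbb R}\mu([a,a+t])\le Kt^\alpha$ for all $t\in[0,1]$. For finite $\Theta\subset\mathbb Z^d$, $H_\Theta$ is the restriction of $\chi_\Theta H\chi_\Theta$ to $\ell^2(\Theta)$. **Localizing boxes.** For $I=I(E,A)=(E-A,E+A)$ with $A>0$ put $h_I(t)=h(\frac{t-E}A)$, where $h(s)=1-s^2$ for $|s|<1$ and $h(s)=0$ otherwise, and $I^L=I(E,A(1-L^{-\kappa})^{-1})$ for $L>1$. A box $\Lambda=\Lambda_L(c)$ is $(m,I)$-localizing for $H$ if $L^{-\kappa'}\le m\le\frac12\log(1+\frac A{4d})$ and there is an orthonormal basis $(\varphi_j)_j$ of $\ell^2(\Lambda)$ with $H_\Lambda\varphi_j=\theta_j\varphi_j$, $\theta_j\in\mathbb R$, such that for each $j$ there is $x_j\in\Lambda$ with $|\varphi_j(y)|\le e^{-m h_I(\theta_j)\|y-x_j\|}$ for all $y\in\Lambda$ with $\|y-x_j\|\ge\lfloor L^\tau\rfloor$. **Conclusions of the multiscale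 analysis.** For $L_0>1$, $E\in\mathbb R$, $A_0>0$, $m_0\in\mathbb R$ and $C_d>0$ let $A_\infty=A_0\prod_{k\ge0}(1-L_0^{-\kappa\gamma^k})$, $m_\infty=m_0\prod_{k\ge0}(1-C_dL_0^{-\varrho\gamma^k})$ and $I_\infty=I(E,A_\infty)$. We say that the conclusions of the multiscale analysis hold for $H_{\boldsymbol\omega}$ (with $L_0,E,A_0,m_0,C_d$) if $L_0^{-\gamma\kappa'}\le m_\infty<\frac12\log(1+\frac{A_\infty}{4d})$ and, for all real $L\ge L_0^\gamma$, $$\inf_{x\in\mathbb R^d}\mathbb P\{\Lambda_L(x)\text{ is }(m_\infty,I_\infty^L)\text{-localizing for }H_{\boldsymbol\omega}\}\ge1-e^{-L^\xi}.$$ **Generalized eigenfunctions.** Let $\mathcal V_{\boldsymbol\omega}(\lambda)$ be the set of all $\psi:\mathbb Z^d\to\mathbb C$, $\psi\ne0$, with $\langle(H_{\boldsymbol\omega}-\lambda)\varphi,\psi\rangle=0$ for all finitely supported $\varphi$ and $\|T_0^{-1}\psi\|_{\ell^2}<\infty$, where $T_a$ is multiplication by $x\mapsto\langle x-a\rangle^\nu$.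 Put $W^{(a)}_{\boldsymbol\omega,\lambda}(b)=\sup_{\psi\in\mathcal V_{\boldsymbol\omega}(\lambda)}|\psi(b)|/\|T_a^{-1}\psi\|$, and $0$ if $\mathcal V_{\boldsymbol\omega}(\lambda)=\emptyset$. Let $A_L(a)=\{y\in\mathbb Z^d:\frac87L\le\|y-a\|\le\frac{33}{14}L\}$. **Statement.** There is a finite scale $\mathcal L$, depending only on $d,\nu$ and the exponents, and, for each $\mu$, a constant $C$, depending only on $d,\nu$, the exponents and $\mu$, such that the following holds. Suppose the conclusions of the multiscale analysis hold for $H_{\boldsymbol\omega}$ with some $L_0,E,A_0,m_0,C_d$, and let $I=I_\infty$, $m=m_\infty$. Then for every even $L\in\mathbb N$ with $L\ge\max\{\mathcal L,L_0^\gamma\}$ and every $a\in\mathbb Z^d$ there is an event $\mathcal Y_{L,a}$ such that: (i) $\mathcal Y_{L,a}$ depends only on the random variables $\{\omega_x\}_{x\in\Lambda_{5L}(a)}$, and $\mathbb P\{\mathcal Y_{L,a}\}\ge1-Ce^{-L^\xi}$. (ii) For all $\boldsymbol\omega\in\mathcal Y_{L,a}$ and $\lambda\in I$: if $\max_{b\in\Lambda_{L/3}(a)}W^{(a)}_{\boldsymbol\omega,\lambda}(b)>e^{-\frac14mh_{I^L}(\lambda)L}$,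 then $W^{(a)}_{\boldsymbol\omega,\lambda}(y)\le e^{-\frac7{132}mh_{I^L}(\lambda)\|y-a\|}$ for all $y\in A_L(a)$. In particular, for all $\boldsymbol\omega\in\mathcal Y_{L,a}$ and $\lambda\in I$, $$W^{(a)}_{\boldsymbol\omega,\lambda}(a)\,W^{(a)}_{\boldsymbol\omega,\lambda}(y)\le e^{-\frac7{132}mh_{I^L}(\lambda)\|y-a\|}\quad\text{for all }y\in A_L(a).$$ -/

import Mathlib

open MeasureTheory ProbabilityTheory

namespace Anderson

noncomputable section

/-- The lattice `ℤ^d`. Its norm `‖x‖` is the sup norm. -/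
abbrev Zd (d : ℕ) : Type := Fin d → ℤ

/-- The inclusion of `ℤ^d` in `ℝ^d` (with the sup norm). -/
def toR {d : ℕ} (x : Zd d) : Fin d → ℝ := fun i => (x i : ℝ)

/-! ### Boxes -/

theorem finite_box {d : ℕ} (L : ℝ) (x : Fin d → ℝ) :
    {y : Zd d | ‖toR y - x‖ ≤ L / 2}.Finite := by
  refine (Set.Finite.pi (fun i : Fin d => Set.finite_Icc ⌈x i - L / 2⌉ ⌊x i + L / 2⌋)).subset ?_
  intro y hy i _
  have h : |(y i : ℝ) - x i| ≤ L / 2 := (norm_le_pi_norm (toR y - x) i).trans hy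
  rw [abs_le] at h
  exact ⟨Int.ceil_le.2 (by linarith), Int.le_floor.2 (by linarith)⟩

/-- The box `Λ_L(x) = {y ∈ ℤ^d : ‖y - x‖ ≤ L / 2}` of side `L` centered at `x ∈ ℝ^d`. -/
def box {d : ℕ} (L : ℝ) (x : Fin d → ℝ) : Finset (Zd d) := (finite_box L x).toFinset

theorem mem_box {d : ℕ} {L : ℝ} {x : Fin d → ℝ} {y : Zd d} :
    y ∈ box L x ↔ ‖toR y - x‖ ≤ L / 2 := by
  simp [box]

/-- The annulus `A_L(a) = {y ∈ ℤ^d : (8/7) L ≤ ‖y - a‖ ≤ (33/14) L}`. -/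
def annulus {d : ℕ} (L : ℝ) (a : Zd d) : Set (Zd d) :=
  {y | 8 / 7 * L ≤ ‖y - a‖ ∧ ‖y - a‖ ≤ 33 / 14 * L}

/-! ### Discrete Schrödinger operators -/

/-- The centered discrete Laplacian: the sum of `φ` over the points at Euclidean distance `1`
from `x`, which are the points `x ± e_i`. -/
def laplacian {d : ℕ} (φ : Zd d → ℂ) (x : Zd d) : ℂ :=
  ∑ i : Fin d, (φ (x + Pi.single i 1) + φ (x - Pi.single i 1))

/-- The action of `H = -Δ + V` on functions on `ℤ^d`. -/
def schrodinger {d : ℕ} (V : Zd d → ℝ) (φ : Zd d → ℂ) (x : Zd d) : ℂ :=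
  -laplacian φ x + (V x : ℂ) * φ x

/-- Extension by zero of a function on the finite set `Θ`. -/
def extendZero {d : ℕ} (Θ : Finset (Zd d)) (φ : Θ → ℂ) (x : Zd d) : ℂ :=
  if h : x ∈ Θ then φ ⟨x, h⟩ else 0

/-- `(φ, lam)` is an eigenpair of `H_Θ`, the restriction of `χ_Θ H χ_Θ` to `ℓ²(Θ)`. -/
def IsEigenpair {d : ℕ} (V : Zd d → ℝ) (Θ : Finset (Zd d)) (φ : EuclideanSpace ℂ Θ)
    (lam : ℝ) : Prop :=
  ‖φ‖ = 1 ∧ ∀ x : Θ, schrodinger V (extendZero Θ φ) x = (lam : ℂ) * φ x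

/-! ### Exponents -/

/-- The exponents attached to `0 < ξ < ζ < 1`. -/
structure Exponents (ξ ζ : ℝ) where
  τ : ℝ
  β : ℝ
  γ : ℝ
  κ : ℝ
  κ' : ℝ
  ξ_pos : 0 < ξ
  ξ_lt_ζ : ξ < ζ
  ζ_lt_β : ζ < β
  β_lt : β < 1 / γ
  one_lt_γ : 1 < γ
  γ_lt : γ < Real.sqrt (ζ / ξ)
  lt_τ : max (γ * β) (((γ - 1) * β + 1) / γ) < τ
  τ_lt_one : τ < 1
  κ_pos : 0 < κ
  κ_lt_one : κ < 1
  κ'_nonneg : 0 ≤ κ'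
  κ'_lt_one : κ' < 1
  κ_add_κ' : κ + κ' < τ - γ * β

/-- `ϱ = min {κ, (1 - τ)/2, γ τ - (γ - 1) (ζ + β)/2 - 1}`. -/
def Exponents.ϱ {ξ ζ : ℝ} (e : Exponents ξ ζ) : ℝ :=
  min e.κ (min ((1 - e.τ) / 2) (e.γ * e.τ - (e.γ - 1) * ((ζ + e.β) / 2) - 1))

/-! ### Localizing boxes -/

/-- `h(s) = 1 - s²` on `(-1, 1)` and `0` elsewhere. -/
def hfun (s : ℝ) : ℝ := if -1 < s ∧ s < 1 then 1 - s ^ 2 else 0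

/-- `h_I` for the interval `I = I(E, A) = (E - A, E + A)`. -/
def hI (E A t : ℝ) : ℝ := hfun ((t - E) / A)

/-- The radius `A (1 - L^{-κ})⁻¹` of the interval `I^L`, where `I = I(E, A)`. -/
def radiusUp (κ A L : ℝ) : ℝ := A * (1 - L ^ (-κ))⁻¹

/-- `φ ∈ ℓ²(Λ_L(c))` is `(x, m)`-localized. -/
def IsLocalizedAt {d : ℕ} (τ L : ℝ) (c : Fin d → ℝ) (φ : EuclideanSpace ℂ (box L c))
    (x : Zd d) (m : ℝ) : Prop :=
  ‖φ‖ = 1 ∧ ∀ y : box L c, (⌊L ^ τ⌋₊ : ℝ) ≤ ‖(y : Zd d) - x‖ →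
    ‖φ y‖ ≤ Real.exp (-(m * ‖(y : Zd d) - x‖))

/-- The box `Λ_L(c)` is `(m, I(E, A))`-localizing for `H = -Δ + V`. -/
def IsLocalizingBox {d : ℕ} {ξ ζ : ℝ} (e : Exponents ξ ζ) (V : Zd d → ℝ)
    (L : ℝ) (c : Fin d → ℝ) (m E A : ℝ) : Prop :=
  L ^ (-e.κ') ≤ m ∧ m ≤ 1 / 2 * Real.log (1 + A / (4 * d)) ∧
  ∃ (φ : OrthonormalBasis (box L c) ℂ (EuclideanSpace ℂ (box L c))) (θ : box L c → ℝ),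
    ∀ j, IsEigenpair V (box L c) (φ j) (θ j) ∧
      ∃ x ∈ box L c, IsLocalizedAt e.τ L c (φ j) x (m * hI E A (θ j))

/-! ### The Anderson model -/

/-- A single-site distribution: a law on `ℝ` with bounded support that is Hölder continuous of
some order `α ∈ (0, 1]`. -/
def IsSingleSiteLaw (μ : Measure ℝ) : Prop :=
  IsProbabilityMeasure μ ∧ (∃ R : ℝ, μ (Set.Icc (-R) R)ᶜ = 0) ∧
  ∃ α K : ℝ, 0 < α ∧ α ≤ 1 ∧
    ∀ t ∈ Set.Icc (0 : ℝ) 1, (⨆ a : ℝ, μ.real (Set.Icc a (a + t))) ≤ K * t ^ α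

/-- The potential of an Anderson model: independent random variables with common law `μ`. -/
def IsAndersonPotential {d : ℕ} {Ω : Type*} [MeasurableSpace Ω] (P : Measure Ω) (μ : Measure ℝ)
    (ω : Zd d → Ω → ℝ) : Prop :=
  (∀ x, Measurable (ω x)) ∧ iIndepFun ω P ∧ ∀ x, P.map (ω x) = μ

/-- The event `Y` depends only on the random variables `ω_x` with `x ∈ Θ`. -/
def DependsOnlyOn {d : ℕ} {Ω : Type*} (ω : Zd d → Ω → ℝ) (Θ : Finset (Zd d)) (Y : Set Ω) :
    Prop :=
  MeasurableSet[⨆ x ∈ Θ, MeasurableSpace.comap (ω x) inferInstance] Y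

/-! ### The conclusions of the eigensystem multiscale analysis -/

/-- `A_∞ = A_0 ∏_{k ≥ 0} (1 - L_0^{-κ γ^k})`. -/
def AInfty {ξ ζ : ℝ} (e : Exponents ξ ζ) (L₀ A₀ : ℝ) : ℝ :=
  A₀ * ∏' k : ℕ, (1 - L₀ ^ (-(e.κ * e.γ ^ k)))

/-- `m_∞ = m_0 ∏_{k ≥ 0} (1 - C_d L_0^{-ϱ γ^k})`. -/
def mInfty {ξ ζ : ℝ} (e : Exponents ξ ζ) (Cd L₀ m₀ : ℝ) : ℝ :=
  m₀ * ∏' k : ℕ, (1 - Cd * L₀ ^ (-(e.ϱ * e.γ ^ k)))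

/-- The conclusions of the multiscale analysis started at scale `L₀`, for `I_∞ = I(E, A)` and
`m_∞ = m`. -/
def MSAConclusions {d : ℕ} {Ω : Type*} [MeasurableSpace Ω] {ξ ζ : ℝ} (e : Exponents ξ ζ)
    (P : Measure Ω) (ω : Zd d → Ω → ℝ) (L₀ E A m : ℝ) : Prop :=
  L₀ ^ (-(e.γ * e.κ')) ≤ m ∧ m < 1 / 2 * Real.log (1 + A / (4 * d)) ∧
  ∀ L : ℝ, L₀ ^ e.γ ≤ L → ∀ c : Fin d → ℝ,
    1 - Real.exp (-L ^ ξ) ≤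
      P.real {s | IsLocalizingBox e (fun x => ω x s) L c m E (radiusUp e.κ A L)}

/-! ### Generalized eigenfunctions -/

/-- `ψ` is a generalized eigenfunction of `H = -Δ + V` on `ℤ^d` with generalized eigenvalue
`lam`: `ψ ≠ 0` and `⟨(H - lam) φ, ψ⟩ = 0` for all finitely supported `φ`. -/
def IsGenEigenfunction {d : ℕ} (V : Zd d → ℝ) (lam : ℝ) (ψ : Zd d → ℂ) : Prop :=
  ψ ≠ 0 ∧ ∀ φ : Zd d → ℂ, φ.support.Finite →
    ∑ᶠ x, (starRingEnd ℂ) (schrodinger V φ x - (lam : ℂ) * φ x) * ψ x = 0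

/-- `⟨x⟩ = √(1 + ‖x‖²)`. -/
def jap {d : ℕ} (x : Zd d) : ℝ := Real.sqrt (1 + ‖x‖ ^ 2)

/-- The function `T_a⁻¹ ψ`, where `T_a` is multiplication by `⟨x - a⟩^ν`. -/
def Tinv {d : ℕ} (ν : ℝ) (a : Zd d) (ψ : Zd d → ℂ) (x : Zd d) : ℂ :=
  ((jap (x - a) ^ ν)⁻¹ : ℝ) * ψ x

/-- The `ℓ²(ℤ^d)` norm of a square summable function. -/
def l2norm {d : ℕ} (f : Zd d → ℂ) : ℝ := Real.sqrt (∑' x, ‖f x‖ ^ 2)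

/-- The set `𝒱(lam)` of `ν`-generalized eigenfunctions with generalized eigenvalue `lam`. -/
def genEigenfunctions {d : ℕ} (ν : ℝ) (V : Zd d → ℝ) (lam : ℝ) : Set (Zd d → ℂ) :=
  {ψ | IsGenEigenfunction V lam ψ ∧ Summable fun x => ‖Tinv ν 0 ψ x‖ ^ 2}

/-- `W_lam^{(a)}(b)`, the supremum over `𝒱(lam)` of `|ψ(b)| / ‖T_a⁻¹ ψ‖`. The set of these
quotients is bounded by `⟨b - a⟩^ν`, and for empty `𝒱(lam)` the value is `0`. -/
def W {d : ℕ} (ν : ℝ) (V : Zd d → ℝ) (lam : ℝ) (a b : Zd d) : ℝ :=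
  ⨆ ψ : genEigenfunctions ν V lam, ‖(ψ : Zd d → ℂ) b‖ / l2norm (Tinv ν a (ψ : Zd d → ℂ))

end

end Anderson

open Anderson

namespace Anderson

section MatrixBounds

variable {ι : Type*} [Fintype ι]

/-- The weighted energy estimate behind the Combes–Thomas bound for `(H² + a)⁻¹`. -/
theorem weighted_energy_le (H : Matrix ι ι ℂ) (hH : H.IsHermitian) (w : ι → ℝ)
    (hw : ∀ x, 0 < w x) {b : ℝ} (hb : 0 < b)
    (hD : ∀ x, ∑ y, ‖H x y‖ * |w x / w y - w y / w x| ≤ b)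
    {f h f₀ : ι → ℂ} (hh : ∀ x, h x = ∑ y, H x y * f y) {a c : ℝ} (hc : 0 ≤ c)
    (hf : ∀ x, ∑ y, H x y * h y + a * f x = c * f₀ x) :
    1 / 2 * ∑ x, (w x * ‖h x‖) ^ 2 + (a - b ^ 2 / 2) * ∑ x, (w x * ‖f x‖) ^ 2 ≤
      c * (√(∑ x, (w x * ‖f₀ x‖) ^ 2) * √(∑ x, (w x * ‖f x‖) ^ 2)) := by
  have hsymm : ∀ x y, ‖H x y‖ = ‖H y x‖ := fun x y => by
    rw [← hH.apply x y, norm_star]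
  set K : ι → ι → ℝ := fun x y => ‖H x y‖ * |w x / w y - w y / w x| with hK
  have hKsymm : ∀ x y, K x y = K y x := fun x y => by
    simp only [hK, hsymm x y, abs_sub_comm (w x / w y)]
  have hK0 : ∀ x y, 0 ≤ K x y := fun x y => by positivity
  set R : ℂ := ∑ x, ∑ y, ((w x ^ 2 - w y ^ 2 : ℝ) : ℂ) * (star (f x) * H x y * h y) with hR
  have hRle : ‖R‖ ≤ b ^ 2 / 2 * ∑ x, (w x * ‖f x‖) ^ 2 + 1 / 2 * ∑ x, (w x * ‖h x‖) ^ 2 := by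
    calc ‖R‖ ≤ ∑ x, ∑ y, K x y * ((w x * ‖f x‖) * (w y * ‖h y‖)) := by
          refine (norm_sum_le _ _).trans (Finset.sum_le_sum fun x _ => (norm_sum_le _ _).trans
            (Finset.sum_le_sum fun y _ => le_of_eq ?_))
          have h1 : w x ^ 2 - w y ^ 2 = (w x / w y - w y / w x) * (w x * w y) := by
            have := (hw x).ne'
            have := (hw y).ne'
            field_simp
          rw [norm_mul, norm_mul, norm_mul, norm_star, Complex.norm_real, h1, norm_mul,
            Real.norm_eq_abs, Real.norm_eq_abs, abs_of_pos (mul_pos (hw x) (hw y))]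
          simp only [hK]
          ring
      _ ≤ ∑ x, ∑ y, (K x y * (b / 2 * (w x * ‖f x‖) ^ 2) +
            K y x * (1 / (2 * b) * (w y * ‖h y‖) ^ 2)) := by
          refine Finset.sum_le_sum fun x _ => Finset.sum_le_sum fun y _ => ?_
          rw [hKsymm y x, ← mul_add]
          refine mul_le_mul_of_nonneg_left ?_ (hK0 x y)
          have h2 : 0 ≤ 1 / (2 * b) * (b * (w x * ‖f x‖) - w y * ‖h y‖) ^ 2 := by positivity
          have h3 : 1 / (2 * b) * (b * (w x * ‖f x‖) - w y * ‖h y‖) ^ 2 =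
              b / 2 * (w x * ‖f x‖) ^ 2 + 1 / (2 * b) * (w y * ‖h y‖) ^ 2 -
                (w x * ‖f x‖) * (w y * ‖h y‖) := by
            field_simp
            ring
          linarith
      _ = ∑ x, (∑ y, K x y) * (b / 2 * (w x * ‖f x‖) ^ 2) +
            ∑ y, (∑ x, K y x) * (1 / (2 * b) * (w y * ‖h y‖) ^ 2) := by
          simp only [Finset.sum_add_distrib, Finset.sum_mul]
          congr 1
          exact Finset.sum_comm
      _ ≤ ∑ x, b * (b / 2 * (w x * ‖f x‖) ^ 2) +
            ∑ y, b * (1 / (2 * b) * (w y * ‖h y‖) ^ 2) := by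
          gcongr with x _ y _
          · exact hD x
          · exact hD y
      _ = _ := by
          rw [Finset.mul_sum, Finset.mul_sum]
          congr 1 <;> refine Finset.sum_congr rfl fun x _ => ?_ <;> field_simp
  have hid : ∑ x, ((w x ^ 2 : ℝ) : ℂ) * (star (f x) * (c * f₀ x)) =
      ((∑ x, (w x * ‖h x‖) ^ 2 : ℝ) : ℂ) + R + ((a * ∑ x, (w x * ‖f x‖) ^ 2 : ℝ) : ℂ) := by
    have h1 : ((∑ x, (w x * ‖h x‖) ^ 2 : ℝ) : ℂ) =
        ∑ x, ∑ y, ((w y ^ 2 : ℝ) : ℂ) * (star (f x) * H x y * h y) := by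
      rw [Finset.sum_comm]
      push_cast
      refine Finset.sum_congr rfl fun y _ => ?_
      have h2 : (star (h y)) = ∑ x, star (f x) * H x y := by
        rw [hh y, star_sum]
        refine Finset.sum_congr rfl fun x _ => ?_
        rw [star_mul, ← hH.apply x y]
      rw [mul_pow, ← Finset.mul_sum, ← Finset.sum_mul, ← h2]
      congr 1
      rw [← Complex.conj_mul']
      rfl
    have h2 : ((a * ∑ x, (w x * ‖f x‖) ^ 2 : ℝ) : ℂ) =
        ∑ x, ((w x ^ 2 : ℝ) : ℂ) * (star (f x) * (a * f x)) := by
      push_cast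
      rw [Finset.mul_sum]
      refine Finset.sum_congr rfl fun x _ => ?_
      rw [mul_pow, ← Complex.conj_mul']
      simp only [Complex.star_def]
      ring
    rw [h1, h2, hR, ← Finset.sum_add_distrib, ← Finset.sum_add_distrib]
    refine Finset.sum_congr rfl fun x _ => ?_
    rw [← Finset.sum_add_distrib, ← hf x, mul_add, Finset.mul_sum, mul_add, Finset.mul_sum]
    congr 1
    refine Finset.sum_congr rfl fun y _ => ?_
    push_cast
    ring
  have hre := congrArg Complex.re hid
  rw [Complex.add_re, Complex.add_re, Complex.ofReal_re, Complex.ofReal_re] at hre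
  have hl : (∑ x, ((w x ^ 2 : ℝ) : ℂ) * (star (f x) * (c * f₀ x))).re ≤
      c * (√(∑ x, (w x * ‖f₀ x‖) ^ 2) * √(∑ x, (w x * ‖f x‖) ^ 2)) := by
    refine (Complex.re_le_norm _).trans ?_
    calc _ ≤ ∑ x, c * ((w x * ‖f₀ x‖) * (w x * ‖f x‖)) := by
          refine (norm_sum_le _ _).trans (Finset.sum_le_sum fun x _ => le_of_eq ?_)
          rw [norm_mul, norm_mul, norm_mul, norm_star, Complex.norm_real, Complex.norm_real,
            Real.norm_of_nonneg hc, Real.norm_of_nonneg (sq_nonneg _)]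
          ring
      _ ≤ _ := by
          rw [← Finset.mul_sum]
          exact mul_le_mul_of_nonneg_left (Real.sum_mul_le_sqrt_mul_sqrt _ _ _) hc
  have hRre := (abs_le.1 (Complex.abs_re_le_norm R)).1
  linarith

end MatrixBounds

section SpectralSum

variable {ι : Type*} [Fintype ι]

/-- The kernel `∑ⱼ g(j) φⱼ(x) conj(φⱼ(u))` of a function of an operator with eigenbasis `φ`. -/
noncomputable def specSum (φ : OrthonormalBasis ι ℂ (EuclideanSpace ℂ ι)) (g : ι → ℝ) (u x : ι) :
    ℂ :=
  ∑ j, (g j : ℂ) * (φ j x * star (φ j u))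

variable (φ : OrthonormalBasis ι ℂ (EuclideanSpace ℂ ι))

theorem eigenbasis_expansion (ψ : ι → ℂ) (x : ι) :
    ψ x = ∑ j, (∑ u, star (φ j u) * ψ u) * φ j x := by
  have h := φ.sum_repr (WithLp.toLp 2 ψ)
  have h1 := congrArg (fun v : EuclideanSpace ℂ ι => v x) h
  simp only [WithLp.ofLp_sum, WithLp.ofLp_smul, Finset.sum_apply, Pi.smul_apply,
    smul_eq_mul] at h1
  rw [← h1]
  refine Finset.sum_congr rfl fun j _ => ?_
  rw [φ.repr_apply_apply, PiLp.inner_apply]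
  congr 1
  refine Finset.sum_congr rfl fun u _ => ?_
  simp [mul_comm]

theorem specSum_one [DecidableEq ι] (u x : ι) :
    specSum φ (fun _ => 1) u x = if x = u then 1 else 0 := by
  have h := eigenbasis_expansion φ (Pi.single u 1) x
  rw [Pi.single_apply] at h
  rw [h, specSum]
  refine Finset.sum_congr rfl fun j _ => ?_
  simp [Pi.single_apply, mul_comm]

theorem mulVec_specSum (H : Matrix ι ι ℂ) {θ : ι → ℝ}
    (hφ : ∀ j x, ∑ y, H x y * φ j y = θ j * φ j x) (g : ι → ℝ) (u x : ι) :
    ∑ y, H x y * specSum φ g u y = specSum φ (fun j => θ j * g j) u x := by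
  simp only [specSum, Finset.mul_sum]
  rw [Finset.sum_comm]
  refine Finset.sum_congr rfl fun j _ => ?_
  push_cast
  calc _ = (∑ y, H x y * φ j y) * (g j * star (φ j u)) := by
        rw [Finset.sum_mul]
        exact Finset.sum_congr rfl fun y _ => by ring
    _ = _ := by
        rw [hφ]
        ring

theorem specSum_add (g g' : ι → ℝ) (u x : ι) :
    specSum φ (fun j => g j + g' j) u x = specSum φ g u x + specSum φ g' u x := by
  simp [specSum, add_mul, Finset.sum_add_distrib]

theorem specSum_const_mul (r : ℝ) (g : ι → ℝ) (u x : ι) :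
    specSum φ (fun j => r * g j) u x = r * specSum φ g u x := by
  simp [specSum, Finset.mul_sum, mul_assoc]

theorem specSum_sum {κ : Type*} (s : Finset κ) (g : κ → ι → ℝ) (u x : ι) :
    specSum φ (fun j => ∑ k ∈ s, g k j) u x = ∑ k ∈ s, specSum φ (g k) u x := by
  simp only [specSum, Complex.ofReal_sum, Finset.sum_mul]
  exact Finset.sum_comm

theorem norm_le_weighted_sqrt_div {w : ι → ℝ} (hw : ∀ x, 0 < w x) (f : ι → ℂ) (y : ι) :
    ‖f y‖ ≤ √(∑ x, (w x * ‖f x‖) ^ 2) / w y := by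
  rw [le_div_iff₀ (hw y), mul_comm]
  exact Real.le_sqrt_of_sq_le
    (Finset.single_le_sum (f := fun x => (w x * ‖f x‖) ^ 2) (fun _ _ => sq_nonneg _)
      (Finset.mem_univ y))

/-- Weighted bounds for the powers of `(λ² + a) (H² + a)⁻¹` applied to a point mass. -/
theorem weighted_specSum_pow_le (H : Matrix ι ι ℂ) (hH : H.IsHermitian) (w : ι → ℝ)
    (hw : ∀ x, 0 < w x) {b : ℝ} (hb : 0 < b)
    (hD : ∀ x, ∑ y, ‖H x y‖ * |w x / w y - w y / w x| ≤ b) {θ : ι → ℝ}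
    (hφ : ∀ j x, ∑ y, H x y * φ j y = θ j * φ j x) {a lam : ℝ} (ha : b ^ 2 / 2 < a) {u : ι}
    (hu : w u = 1) (k : ℕ) :
    √(∑ x, (w x * ‖specSum φ (fun j => ((lam ^ 2 + a) / (θ j ^ 2 + a)) ^ k) u x‖) ^ 2) ≤
        ((lam ^ 2 + a) / (a - b ^ 2 / 2)) ^ k ∧
      √(∑ x, (w x * ‖specSum φ (fun j => θ j * ((lam ^ 2 + a) / (θ j ^ 2 + a)) ^ (k + 1)) u x‖)
          ^ 2) ≤
        √(2 * (lam ^ 2 + a)) * ((lam ^ 2 + a) / (a - b ^ 2 / 2)) ^ (k + 1) := by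
  classical
  have ha0 : 0 < a := lt_of_le_of_lt (by positivity) ha
  have hc : 0 < lam ^ 2 + a := by positivity
  have hab : 0 < a - b ^ 2 / 2 := by linarith
  set c := lam ^ 2 + a with hcdef
  set G := c / (a - b ^ 2 / 2) with hG
  have hG1 : 1 ≤ G := by
    rw [hG, one_le_div hab]
    nlinarith [sq_nonneg lam, sq_nonneg b]
  set f : ℕ → ι → ℂ := fun k => specSum φ (fun j => (c / (θ j ^ 2 + a)) ^ k) u with hf
  set h : ℕ → ι → ℂ := fun k => specSum φ (fun j => θ j * (c / (θ j ^ 2 + a)) ^ k) u with hh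
  have key : ∀ k, 1 / 2 * ∑ x, (w x * ‖h (k + 1) x‖) ^ 2 +
      (a - b ^ 2 / 2) * ∑ x, (w x * ‖f (k + 1) x‖) ^ 2 ≤
      c * (√(∑ x, (w x * ‖f k x‖) ^ 2) * √(∑ x, (w x * ‖f (k + 1) x‖) ^ 2)) := by
    intro k
    refine weighted_energy_le H hH w hw hb hD (fun x => ?_) hc.le (fun x => ?_)
    · exact (mulVec_specSum φ H hφ _ u x).symm
    · simp only [hf, hh]
      rw [mulVec_specSum φ H hφ, ← specSum_const_mul, ← specSum_add, ← specSum_const_mul]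
      congr 1
      funext j
      have : θ j ^ 2 + a ≠ 0 := by positivity
      rw [pow_succ]
      field_simp
  have hstep : ∀ k, √(∑ x, (w x * ‖f (k + 1) x‖) ^ 2) ≤ G * √(∑ x, (w x * ‖f k x‖) ^ 2) := by
    intro k
    set X := √(∑ x, (w x * ‖f (k + 1) x‖) ^ 2) with hX
    have hX2 : ∑ x, (w x * ‖f (k + 1) x‖) ^ 2 = X ^ 2 :=
      (Real.sq_sqrt (Finset.sum_nonneg fun _ _ => sq_nonneg _)).symm
    have h1 := key k
    rw [← hX, hX2] at h1
    have h0 : 0 ≤ ∑ x, (w x * ‖h (k + 1) x‖) ^ 2 := Finset.sum_nonneg fun _ _ => sq_nonneg _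
    have hX0 : 0 ≤ X := Real.sqrt_nonneg _
    rcases hX0.eq_or_lt with h2 | h2
    · rw [← h2]
      positivity
    · rw [hG, div_mul_eq_mul_div, le_div_iff₀ hab]
      refine le_of_mul_le_mul_right ?_ h2
      linarith
  have hpow : ∀ k, √(∑ x, (w x * ‖f k x‖) ^ 2) ≤ G ^ k := by
    intro k
    induction k with
    | zero =>
      have h1 : ∀ x, (w x * ‖f 0 x‖) ^ 2 = if x = u then 1 else 0 := by
        intro x
        simp only [hf, pow_zero, specSum_one]
        split_ifs with hx
        · simp [hx, hu]
        · simp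
      simp [h1]
    | succ k ih =>
      rw [pow_succ']
      exact (hstep k).trans (by gcongr)
  refine ⟨hpow k, ?_⟩
  have h1 := key k
  have h2 := hpow k
  have h3 := hpow (k + 1)
  have h0 : 0 ≤ ∑ x, (w x * ‖f (k + 1) x‖) ^ 2 := Finset.sum_nonneg fun _ _ => sq_nonneg _
  have h4 : G ^ k ≤ G ^ (k + 1) := pow_le_pow_right₀ hG1 (Nat.le_succ k)
  have h5 : √(∑ x, (w x * ‖f k x‖) ^ 2) * √(∑ x, (w x * ‖f (k + 1) x‖) ^ 2) ≤
      (G ^ (k + 1)) ^ 2 := by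
    rw [sq]
    exact mul_le_mul (h2.trans h4) h3 (Real.sqrt_nonneg _) (by positivity)
  refine (Real.sqrt_le_sqrt (y := 2 * c * (G ^ (k + 1)) ^ 2) ?_).trans (le_of_eq ?_)
  · have := mul_le_mul_of_nonneg_left h5 hc.le
    have := mul_nonneg hab.le h0
    linarith
  · rw [Real.sqrt_mul (by positivity), Real.sqrt_sq (by positivity)]

/-- The resolvent kernel, up to the part regularized by a power of `(λ² + a) (H² + a)⁻¹`. -/
theorem norm_resolvent_le (H : Matrix ι ι ℂ) (hH : H.IsHermitian) (w : ι → ℝ)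
    (hw : ∀ x, 0 < w x) {b : ℝ} (hb : 0 < b)
    (hD : ∀ x, ∑ y, ‖H x y‖ * |w x / w y - w y / w x| ≤ b) {θ : ι → ℝ}
    (hφ : ∀ j x, ∑ y, H x y * φ j y = θ j * φ j x) {a lam : ℝ} (ha : b ^ 2 / 2 < a)
    (hlam : ∀ j, θ j ≠ lam) {u : ι} (hu : w u = 1) (y : ι) (n : ℕ) :
    ‖specSum φ (fun j => (θ j - lam)⁻¹) u y‖ ≤
      ‖specSum φ (fun j => ((lam ^ 2 + a) / (θ j ^ 2 + a)) ^ n * (θ j - lam)⁻¹) u y‖ +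
      n / (lam ^ 2 + a) * (√(2 * (lam ^ 2 + a)) + |lam|) *
        ((lam ^ 2 + a) / (a - b ^ 2 / 2)) ^ n / w y := by
  have ha0 : 0 < a := lt_of_le_of_lt (by positivity) ha
  have hc : 0 < lam ^ 2 + a := by positivity
  have hab : 0 < a - b ^ 2 / 2 := by linarith
  set c := lam ^ 2 + a with hcdef
  set G := c / (a - b ^ 2 / 2) with hG
  have hG1 : 1 ≤ G := by
    rw [hG, one_le_div hab]
    nlinarith [sq_nonneg lam, sq_nonneg b]
  have hsplit : specSum φ (fun j => (θ j - lam)⁻¹) u y =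
      specSum φ (fun j => (c / (θ j ^ 2 + a)) ^ n * (θ j - lam)⁻¹) u y +
      (c⁻¹ : ℝ) * ∑ k ∈ Finset.range n,
        (specSum φ (fun j => θ j * (c / (θ j ^ 2 + a)) ^ (k + 1)) u y +
          lam * specSum φ (fun j => (c / (θ j ^ 2 + a)) ^ (k + 1)) u y) := by
    simp only [← specSum_const_mul, ← specSum_add, ← specSum_sum]
    congr 1
    funext j
    have h1 : θ j - lam ≠ 0 := sub_ne_zero.2 (hlam j)
    have h2 : θ j ^ 2 + a ≠ 0 := by positivity
    set q := c / (θ j ^ 2 + a) with hq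
    have h3 : 1 - q = (θ j + lam) * (θ j - lam) * q / c := by
      rw [hq]
      field_simp
      rw [hcdef]
      ring
    have h4 := mul_neg_geom_sum q n
    have h5 : ∑ k ∈ Finset.range n, (θ j * q ^ (k + 1) + lam * q ^ (k + 1)) =
        (θ j + lam) * q * ∑ k ∈ Finset.range n, q ^ k := by
      rw [Finset.mul_sum]
      exact Finset.sum_congr rfl fun k _ => by ring
    rw [h5]
    rw [h3] at h4
    have h6 : (θ j + lam) * q * ∑ k ∈ Finset.range n, q ^ k = c * (1 - q ^ n) * (θ j - lam)⁻¹ := by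
      rw [← h4]
      field_simp
    rw [h6]
    field_simp
    ring
  rw [hsplit]
  refine (norm_add_le _ _).trans (add_le_add_right ?_ _)
  have hterm : ∀ k ∈ Finset.range n,
      ‖specSum φ (fun j => θ j * (c / (θ j ^ 2 + a)) ^ (k + 1)) u y +
          lam * specSum φ (fun j => (c / (θ j ^ 2 + a)) ^ (k + 1)) u y‖ ≤
        (√(2 * c) + |lam|) * G ^ n / w y := by
    intro k hk
    have hkn : G ^ (k + 1) ≤ G ^ n := pow_le_pow_right₀ hG1 (Finset.mem_range.1 hk)
    have h1 := (weighted_specSum_pow_le φ H hH w hw hb hD hφ (lam := lam) ha hu k).2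
    have h2 := (weighted_specSum_pow_le φ H hH w hw hb hD hφ (lam := lam) ha hu (k + 1)).1
    refine (norm_add_le _ _).trans ?_
    rw [add_mul, add_div]
    refine add_le_add ?_ ?_
    · refine (norm_le_weighted_sqrt_div hw _ y).trans ?_
      refine div_le_div_of_nonneg_right (h1.trans ?_) (hw y).le
      exact mul_le_mul_of_nonneg_left hkn (Real.sqrt_nonneg _)
    · rw [norm_mul, Complex.norm_real, Real.norm_eq_abs, mul_div_assoc]
      refine mul_le_mul_of_nonneg_left ?_ (abs_nonneg _)
      exact (norm_le_weighted_sqrt_div hw _ y).trans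
        (div_le_div_of_nonneg_right (h2.trans hkn) (hw y).le)
  rw [norm_mul, Complex.norm_real, Real.norm_of_nonneg (by positivity)]
  refine (mul_le_mul_of_nonneg_left ((norm_sum_le _ _).trans (Finset.sum_le_sum hterm))
    (by positivity)).trans (le_of_eq ?_)
  rw [Finset.sum_const, Finset.card_range, nsmul_eq_mul]
  field_simp

end SpectralSum

theorem one_sub_sq_le_hfun (s : ℝ) : 1 - s ^ 2 ≤ hfun s := by
  unfold hfun
  split_ifs with h
  · exact le_rfl
  · by_contra hs
    exact h (abs_lt.1 ((sq_lt_one_iff_abs_lt_one s).1 (by linarith)))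

theorem hfun_nonneg (s : ℝ) : 0 ≤ hfun s := by
  unfold hfun
  split_ifs with h
  · have := (sq_lt_one_iff_abs_lt_one s).2 (abs_lt.2 h)
    linarith
  · exact le_rfl

theorem hfun_of_abs_lt {s : ℝ} (hs : |s| < 1) : hfun s = 1 - s ^ 2 := if_pos (abs_lt.1 hs)

theorem hfun_le_one (s : ℝ) : hfun s ≤ 1 := by
  unfold hfun
  split_ifs with h
  · nlinarith [sq_nonneg s]
  · exact zero_le_one

theorem hfun_eq_max (s : ℝ) : hfun s = max 0 (1 - s ^ 2) := by
  refine le_antisymm ?_ (max_le (hfun_nonneg s) (one_sub_sq_le_hfun s))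
  unfold hfun
  split_ifs
  · exact le_max_right _ _
  · exact le_max_left _ _

/-- A power of `(λ² + a) / (θ² + a)` compensates the loss of decay at the eigenvalue `θ`. -/
theorem ratio_pow_mul_exp_le {A p a lam θ : ℝ} {n : ℕ} (hA : 0 < A) (hp : 0 < p) (ha : 0 < a)
    (hna : n * A ^ 2 = p * a) (hpa : p * A ^ 2 ≤ a) (hlam : |lam| < A) :
    ((lam ^ 2 + a) / (θ ^ 2 + a)) ^ n * Real.exp (-(p * hfun (θ / A))) ≤
      Real.exp 1 * Real.exp (-(p * (1 - (lam / A) ^ 2))) := by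
  have hl2 : lam ^ 2 ≤ A ^ 2 := sq_le_sq' (by linarith [abs_lt.1 hlam]) (abs_lt.1 hlam).2.le
  have hn : (n : ℝ) = p * a / A ^ 2 := by
    rw [eq_div_iff (by positivity), hna]
  have hq : (lam ^ 2 + a) / (θ ^ 2 + a) ≤ Real.exp ((lam ^ 2 - θ ^ 2) / (θ ^ 2 + a)) := by
    refine le_trans (le_of_eq ?_) (Real.add_one_le_exp _)
    field_simp
    ring
  have hq0 : 0 ≤ (lam ^ 2 + a) / (θ ^ 2 + a) := by positivity
  have hpow := pow_le_pow_left₀ hq0 hq n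
  rw [← Real.exp_nat_mul] at hpow
  refine (mul_le_mul_of_nonneg_right hpow (Real.exp_pos _).le).trans ?_
  rw [← Real.exp_add, ← Real.exp_add, Real.exp_le_exp, hn]
  have hA2 : 0 < A ^ 2 := by positivity
  have haA : 0 < A ^ 2 + a := by positivity
  by_cases hθ : θ ^ 2 ≤ A ^ 2
  · have h1 := one_sub_sq_le_hfun (θ / A)
    have h2 : p * (1 - (θ / A) ^ 2) ≤ p * hfun (θ / A) := by gcongr
    have h3 : p * a / A ^ 2 * ((lam ^ 2 - θ ^ 2) / (θ ^ 2 + a)) ≤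
        p * (lam ^ 2 - θ ^ 2) / A ^ 2 + 1 := by
      have h4 : p * a / A ^ 2 * ((lam ^ 2 - θ ^ 2) / (θ ^ 2 + a)) =
          p * (lam ^ 2 - θ ^ 2) / A ^ 2 + p * (θ ^ 2 - lam ^ 2) * θ ^ 2 / (A ^ 2 * (θ ^ 2 + a)) := by
        field_simp
        ring
      rw [h4]
      gcongr
      rw [div_le_one (by positivity)]
      have h5 : (θ ^ 2 - lam ^ 2) * θ ^ 2 ≤ A ^ 2 * A ^ 2 := by
        nlinarith [sq_nonneg lam, sq_nonneg θ, mul_nonneg (sq_nonneg lam) (sq_nonneg θ)]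
      nlinarith [sq_nonneg θ]
    have h6 : p * (lam ^ 2 - θ ^ 2) / A ^ 2 = p * (1 - (θ / A) ^ 2) - p * (1 - (lam / A) ^ 2) := by
      field_simp
      ring
    linarith
  · push Not at hθ
    have h1 : 0 ≤ p * hfun (θ / A) := mul_nonneg hp.le (hfun_nonneg _)
    have h3 : p * a / A ^ 2 * ((lam ^ 2 - θ ^ 2) / (θ ^ 2 + a)) ≤
        p * a / A ^ 2 * ((lam ^ 2 - A ^ 2) / (A ^ 2 + a)) := by
      refine mul_le_mul_of_nonneg_left ?_ (by positivity)
      rw [div_le_div_iff₀ (by positivity) haA]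
      nlinarith [sq_nonneg lam]
    have h4 : p * a / A ^ 2 * ((lam ^ 2 - A ^ 2) / (A ^ 2 + a)) ≤
        1 - p * (1 - (lam / A) ^ 2) := by
      have h5 : p * a / A ^ 2 * ((lam ^ 2 - A ^ 2) / (A ^ 2 + a)) =
          -(p * (1 - (lam / A) ^ 2)) + p * (A ^ 2 - lam ^ 2) / (A ^ 2 + a) := by
        field_simp
        ring
      rw [h5]
      have h6 : p * (A ^ 2 - lam ^ 2) / (A ^ 2 + a) ≤ 1 := by
        rw [div_le_one haA]
        nlinarith [sq_nonneg lam]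
      linarith
    linarith

theorem sq_le_sixteen_mul_exp_half {p : ℝ} (hp : 0 ≤ p) : p ^ 2 ≤ 16 * Real.exp (p / 2) := by
  have h := Real.add_one_le_exp (p / 4)
  have h2 : Real.exp (p / 2) = Real.exp (p / 4) ^ 2 := by
    rw [← Real.exp_nat_mul]
    congr 1
    push_cast
    ring
  rw [h2]
  nlinarith

theorem smooth_part_le {A p a lam W : ℝ} {n : ℕ} (hA : 0 < A) (hp : 1 ≤ p)
    (hna : n * A ^ 2 = p * a) (hn : p ^ 2 ≤ n) (hn' : (n : ℝ) ≤ 2 * p ^ 2) (hlam : |lam| < A)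
    (hW : Real.exp (2 * p) ≤ W) :
    n / (lam ^ 2 + a) * (√(2 * (lam ^ 2 + a)) + |lam|) *
        ((lam ^ 2 + a) / (a - A ^ 2 / 2)) ^ n / W ≤
      240 / A * Real.exp (-(p * (1 - (lam / A) ^ 2))) := by
  have hp0 : 0 < p := by linarith
  have hA2 : 0 < A ^ 2 := by positivity
  have hl2 : lam ^ 2 ≤ A ^ 2 := sq_le_sq' (by linarith [abs_lt.1 hlam]) (abs_lt.1 hlam).2.le
  have hpa : p * A ^ 2 ≤ a := by
    have : p * (p * A ^ 2) ≤ p * a := by nlinarith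
    exact le_of_mul_le_mul_left this hp0
  have haA : A ^ 2 ≤ a := by nlinarith
  have ha : 0 < a := by linarith
  have hab : 0 < a - A ^ 2 / 2 := by linarith
  set c := lam ^ 2 + a with hc
  have hca : a ≤ c := by nlinarith [sq_nonneg lam]
  have hc0 : 0 < c := by linarith
  have hn0 : (0 : ℝ) ≤ n := n.cast_nonneg
  have h1 : n / c * (√(2 * c) + |lam|) ≤ 3 * p ^ 2 / A := by
    have h2 : n / c * √(2 * c) ≤ 2 * p ^ 2 / A := by
      refine le_of_sq_le_sq ?_ (by positivity)
      rw [mul_pow, Real.sq_sqrt (by positivity), div_pow, div_pow]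
      have h3 : (n : ℝ) ^ 2 / c ^ 2 * (2 * c) = 2 * n ^ 2 / c := by
        field_simp
      rw [h3, div_le_div_iff₀ hc0 hA2]
      have h4 : (n : ℝ) ^ 2 * A ^ 2 = n * (p * a) := by
        rw [← hna]
        ring
      have h5 : (n : ℝ) * (p * a) ≤ 2 * p ^ 2 * (p * c) := by gcongr
      have h6 : p ^ 3 ≤ p ^ 4 := pow_le_pow_right₀ hp (by norm_num)
      nlinarith
    have h7 : n / c * |lam| ≤ p ^ 2 / A := by
      rw [div_mul_eq_mul_div, div_le_div_iff₀ hc0 hA]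
      have h8 : n * |lam| * A ≤ n * A * A := by gcongr
      have h9 : p * a ≤ p ^ 2 * c := by
        rw [sq, mul_assoc]
        refine mul_le_mul_of_nonneg_left ?_ hp0.le
        nlinarith
      nlinarith
    rw [mul_add]
    refine (add_le_add h2 h7).trans (le_of_eq (by ring))
  have hG : (c / (a - A ^ 2 / 2)) ^ n ≤ Real.exp (p * ((lam / A) ^ 2 + 1 / 2) + 3 / 2) := by
    have h2 : c / (a - A ^ 2 / 2) ≤ Real.exp ((lam ^ 2 + A ^ 2 / 2) / (a - A ^ 2 / 2)) := by
      refine le_trans (le_of_eq ?_) (Real.add_one_le_exp _)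
      rw [div_add_one hab.ne', hc]
      congr 1
      ring
    have h3 := pow_le_pow_left₀ (by positivity) h2 n
    rw [← Real.exp_nat_mul] at h3
    refine h3.trans (Real.exp_le_exp.2 ?_)
    have h4 : (n : ℝ) / (a - A ^ 2 / 2) ≤ (p + 1) / A ^ 2 := by
      rw [div_le_div_iff₀ hab hA2, hna]
      nlinarith
    have h5 : (lam / A) ^ 2 ≤ 1 := by
      rw [div_pow]
      exact (div_le_one hA2).2 hl2
    calc (n : ℝ) * ((lam ^ 2 + A ^ 2 / 2) / (a - A ^ 2 / 2))
        = n / (a - A ^ 2 / 2) * (lam ^ 2 + A ^ 2 / 2) := by ring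
      _ ≤ (p + 1) / A ^ 2 * (lam ^ 2 + A ^ 2 / 2) := by gcongr
      _ = (p + 1) * ((lam / A) ^ 2 + 1 / 2) := by
          field_simp
      _ ≤ _ := by nlinarith
  have hE : Real.exp (p * ((lam / A) ^ 2 + 1 / 2) + 3 / 2) / W ≤
      Real.exp (3 / 2) * Real.exp (-(p / 2)) * Real.exp (-(p * (1 - (lam / A) ^ 2))) := by
    refine (div_le_div_of_nonneg_left (Real.exp_pos _).le (Real.exp_pos _) hW).trans
      (le_of_eq ?_)
    rw [← Real.exp_sub, ← Real.exp_add, ← Real.exp_add]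
    congr 1
    ring
  have h32 : Real.exp (3 / 2) ≤ 5 := by
    have h := Real.exp_one_lt_d9
    have h2 : Real.exp (3 / 2) ^ 2 = Real.exp 1 ^ 3 := by
      rw [← Real.exp_nat_mul, ← Real.exp_nat_mul]
      norm_num
    have h3 : Real.exp 1 ^ 3 ≤ 5 ^ 2 := by
      calc Real.exp 1 ^ 3 ≤ (2.72 : ℝ) ^ 3 := by
            gcongr
            linarith
        _ ≤ _ := by norm_num
    exact le_of_sq_le_sq (by rw [h2]; exact h3) (by norm_num)
  have hpe : p ^ 2 * Real.exp (-(p / 2)) ≤ 16 := by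
    rw [Real.exp_neg, ← div_eq_mul_inv, div_le_iff₀ (Real.exp_pos _)]
    exact sq_le_sixteen_mul_exp_half hp0.le
  have hW0 : 0 < W := (Real.exp_pos _).trans_le hW
  calc n / c * (√(2 * c) + |lam|) * (c / (a - A ^ 2 / 2)) ^ n / W
      ≤ 3 * p ^ 2 / A * Real.exp (p * ((lam / A) ^ 2 + 1 / 2) + 3 / 2) / W := by gcongr
    _ = 3 * p ^ 2 / A * (Real.exp (p * ((lam / A) ^ 2 + 1 / 2) + 3 / 2) / W) := by ring
    _ ≤ 3 * p ^ 2 / A *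
        (Real.exp (3 / 2) * Real.exp (-(p / 2)) * Real.exp (-(p * (1 - (lam / A) ^ 2)))) := by
        gcongr
    _ = 3 / A * (p ^ 2 * Real.exp (-(p / 2))) * Real.exp (3 / 2) *
        Real.exp (-(p * (1 - (lam / A) ^ 2))) := by ring
    _ ≤ 3 / A * 16 * 5 * Real.exp (-(p * (1 - (lam / A) ^ 2))) := by gcongr
    _ = _ := by ring

/-- Decay of the resolvent kernel from localization of the eigenfunctions. -/
theorem norm_resolvent_le_exp {ι : Type*} [Fintype ι]
    (φ : OrthonormalBasis ι ℂ (EuclideanSpace ℂ ι)) (H : Matrix ι ι ℂ) (hH : H.IsHermitian)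
    (w : ι → ℝ) (hw : ∀ x, 0 < w x) {A : ℝ} (hA : 0 < A)
    (hD : ∀ x, ∑ y, ‖H x y‖ * |w x / w y - w y / w x| ≤ A) {θ : ι → ℝ}
    (hφ : ∀ j x, ∑ y, H x y * φ j y = θ j * φ j x) {lam δ p : ℝ} (hlam : |lam| < A)
    (hδ : 0 < δ) (hgap : ∀ j, δ ≤ |θ j - lam|) (hp : 1 ≤ p) {u y : ι} (hu : w u = 1)
    (hy : Real.exp (2 * p) ≤ w y)
    (hloc : ∀ j, ‖φ j y‖ * ‖φ j u‖ ≤ Real.exp (-(p * hfun (θ j / A)))) :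
    ‖specSum φ (fun j => (θ j - lam)⁻¹) u y‖ ≤
      (3 * Fintype.card ι / δ + 240 / A) * Real.exp (-(p * (1 - (lam / A) ^ 2))) := by
  have hp0 : 0 < p := by linarith
  set n := ⌈p ^ 2⌉₊ with hn
  have hn1 : p ^ 2 ≤ n := Nat.le_ceil _
  have hn2 : (n : ℝ) ≤ 2 * p ^ 2 := by
    have := (Nat.ceil_lt_add_one (sq_nonneg p)).le
    nlinarith
  set a := n * A ^ 2 / p with ha
  have hna : n * A ^ 2 = p * a := by
    rw [ha]
    field_simp
  have hA2 : 0 < A ^ 2 := by positivity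
  have hpa : p * A ^ 2 ≤ a := by
    have : p * (p * A ^ 2) ≤ p * a := by nlinarith
    exact le_of_mul_le_mul_left this hp0
  have ha' : A ^ 2 / 2 < a := by nlinarith
  have ha0 : 0 < a := by linarith
  refine (norm_resolvent_le φ H hH w hw hA hD hφ ha' (fun j h => ?_) hu y n).trans ?_
  · have := hgap j
    rw [h, sub_self, abs_zero] at this
    linarith
  rw [add_mul]
  refine add_le_add ?_ (smooth_part_le hA hp hna hn1 hn2 hlam hy)
  refine (norm_sum_le _ _).trans ?_
  have hterm : ∀ j ∈ Finset.univ, ‖((((lam ^ 2 + a) / (θ j ^ 2 + a)) ^ n * (θ j - lam)⁻¹ : ℝ) : ℂ) *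
      (φ j y * star (φ j u))‖ ≤ 3 / δ * Real.exp (-(p * (1 - (lam / A) ^ 2))) := by
    intro j _
    rw [norm_mul, Complex.norm_real, norm_mul, norm_mul, norm_star, norm_inv, Real.norm_eq_abs,
      Real.norm_eq_abs, abs_of_nonneg (by positivity)]
    calc _ ≤ ((lam ^ 2 + a) / (θ j ^ 2 + a)) ^ n * δ⁻¹ * Real.exp (-(p * hfun (θ j / A))) := by
          gcongr
          · exact hgap j
          · exact hloc j
      _ = δ⁻¹ * (((lam ^ 2 + a) / (θ j ^ 2 + a)) ^ n * Real.exp (-(p * hfun (θ j / A)))) := by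
          ring
      _ ≤ δ⁻¹ * (Real.exp 1 * Real.exp (-(p * (1 - (lam / A) ^ 2)))) := by
          exact mul_le_mul_of_nonneg_left (ratio_pow_mul_exp_le hA hp0 ha0 hna hpa hlam)
            (by positivity)
      _ ≤ δ⁻¹ * (3 * Real.exp (-(p * (1 - (lam / A) ^ 2)))) := by
          gcongr
          linarith [Real.exp_one_lt_d9]
      _ = _ := by ring
  refine (Finset.sum_le_sum hterm).trans (le_of_eq ?_)
  rw [Finset.sum_const, Finset.card_univ, nsmul_eq_mul]
  ring

section Lattice

variable {d : ℕ}

theorem norm_toR (x : Zd d) : ‖toR x‖ = ‖x‖ := by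
  refine le_antisymm ?_ ?_
  · exact (pi_norm_le_iff_of_nonneg (norm_nonneg _)).2 fun i => by
      simpa [toR, Int.norm_eq_abs] using norm_le_pi_norm x i
  · exact (pi_norm_le_iff_of_nonneg (norm_nonneg _)).2 fun i => by
      simpa [toR, Int.norm_eq_abs] using norm_le_pi_norm (toR x) i

theorem toR_sub (x y : Zd d) : toR (x - y) = toR x - toR y := by
  ext i
  simp [toR]

theorem norm_toR_sub (x y : Zd d) : ‖toR x - toR y‖ = ‖x - y‖ := by
  rw [← toR_sub, norm_toR]

theorem norm_unit (i : Fin d) : ‖(Pi.single i 1 : Zd d)‖ = 1 := by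
  rw [Pi.norm_single]
  simp

/-! ### The matrix of the Hamiltonian -/

/-- The matrix of `H_Θ - E`. -/
noncomputable def hamMatrix (V : Zd d → ℝ) (E : ℝ) (Θ : Finset (Zd d)) : Matrix Θ Θ ℂ :=
  fun x y =>
    -∑ i : Fin d, ((if (y : Zd d) = (x : Zd d) + Pi.single i 1 then 1 else 0) +
      (if (y : Zd d) = (x : Zd d) - Pi.single i 1 then 1 else 0)) + (if y = x then ((V x - E : ℝ) : ℂ) else 0)

theorem sum_ite_mul_eq_extendZero (Θ : Finset (Zd d)) (f : Θ → ℂ) (z : Zd d) :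
    ∑ y : Θ, (if (y : Zd d) = z then 1 else 0) * f y = extendZero Θ f z := by
  unfold extendZero
  split_ifs with h
  · rw [Finset.sum_eq_single ⟨z, h⟩]
    · simp
    · intro y _ hy
      rw [if_neg fun h' => hy (Subtype.ext h'), zero_mul]
    · simp
  · refine Finset.sum_eq_zero fun y _ => ?_
    rw [if_neg, zero_mul]
    rintro rfl
    exact h y.2

theorem extendZero_coe (Θ : Finset (Zd d)) (f : Θ → ℂ) (x : Θ) : extendZero Θ f x = f x := by
  simp [extendZero]

theorem sum_hamMatrix_mul (V : Zd d → ℝ) (E : ℝ) (Θ : Finset (Zd d)) (f : Θ → ℂ) (x : Θ) :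
    ∑ y, hamMatrix V E Θ x y * f y = schrodinger V (extendZero Θ f) x - E * f x := by
  simp only [hamMatrix, schrodinger, laplacian, add_mul, neg_mul, Finset.sum_add_distrib,
    Finset.sum_mul, Finset.sum_neg_distrib]
  rw [Finset.sum_comm]
  nth_rewrite 2 [Finset.sum_comm]
  simp only [sum_ite_mul_eq_extendZero]
  rw [extendZero_coe]
  simp
  ring

theorem hamMatrix_isHermitian (V : Zd d → ℝ) (E : ℝ) (Θ : Finset (Zd d)) :
    (hamMatrix V E Θ).IsHermitian := by
  refine Matrix.IsHermitian.ext fun x y => ?_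
  have h1 : ∀ i : Fin d, (x : Zd d) = (y : Zd d) + Pi.single i 1 ↔ (y : Zd d) = (x : Zd d) - Pi.single i 1 :=
    fun i => by rw [eq_sub_iff_add_eq, eq_comm]
  have h2 : ∀ i : Fin d, (x : Zd d) = (y : Zd d) - Pi.single i 1 ↔ (y : Zd d) = (x : Zd d) + Pi.single i 1 :=
    fun i => by rw [eq_sub_iff_add_eq, eq_comm]
  simp only [hamMatrix, h1, h2]
  by_cases hxy : x = y
  · subst hxy
    simp [add_comm]
  · simp [add_comm, hxy, Ne.symm hxy, apply_ite (starRingEnd ℂ)]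

theorem sum_norm_hamMatrix_mul_le (V : Zd d → ℝ) (E : ℝ) (Θ : Finset (Zd d)) {g : Zd d → ℝ}
    (hg0 : ∀ y, 0 ≤ g y) (x : Θ) (hgx : g x = 0) {K : ℝ}
    (hgK : ∀ y : Zd d, ‖y - x‖ ≤ 1 → g y ≤ K) :
    ∑ y : Θ, ‖hamMatrix V E Θ x y‖ * g y ≤ 2 * d * K := by
  have hK : 0 ≤ K := (hg0 x).trans (hgK x (by simp))
  have hpt : ∀ z : Zd d, ‖z - x‖ ≤ 1 → ∑ y : Θ, (if (y : Zd d) = z then 1 else 0) * g y ≤ K := by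
    intro z hz
    by_cases h : z ∈ Θ
    · rw [Finset.sum_eq_single ⟨z, h⟩]
      · simpa using hgK z hz
      · intro y _ hy
        rw [if_neg fun h' => hy (Subtype.ext h'), zero_mul]
      · simp
    · refine le_of_eq_of_le (Finset.sum_eq_zero fun y _ => ?_) hK
      rw [if_neg, zero_mul]
      rintro rfl
      exact h y.2
  calc ∑ y : Θ, ‖hamMatrix V E Θ x y‖ * g y
      ≤ ∑ y : Θ, ∑ i : Fin d, ((if (y : Zd d) = (x : Zd d) + Pi.single i 1 then 1 else 0) * g y +
        (if (y : Zd d) = (x : Zd d) - Pi.single i 1 then 1 else 0) * g y) := by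
        refine Finset.sum_le_sum fun y _ => ?_
        by_cases hy : y = x
        · rw [hy, hgx, mul_zero]
          simp
        · simp only [← add_mul, ← Finset.sum_mul]
          refine mul_le_mul_of_nonneg_right ?_ (hg0 y)
          simp only [hamMatrix, if_neg hy, add_zero, norm_neg]
          refine (norm_sum_le _ _).trans (Finset.sum_le_sum fun i _ => ?_)
          refine (norm_add_le _ _).trans (le_of_eq ?_)
          split_ifs <;> simp
    _ = ∑ i : Fin d, (∑ y : Θ, (if (y : Zd d) = (x : Zd d) + Pi.single i 1 then 1 else 0) * g y +
        ∑ y : Θ, (if (y : Zd d) = (x : Zd d) - Pi.single i 1 then 1 else 0) * g y) := by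
        rw [Finset.sum_comm]
        simp only [Finset.sum_add_distrib]
    _ ≤ ∑ _i : Fin d, (K + K) := by
        refine Finset.sum_le_sum fun i _ => add_le_add (hpt _ ?_) (hpt _ ?_)
        · simp [norm_unit]
        · simp [norm_unit]
    _ = 2 * d * K := by
        simp
        ring

theorem abs_exp_sub_exp_neg_le {s ρ : ℝ} (hs : |s| ≤ ρ) :
    |Real.exp s - Real.exp (-s)| ≤ 2 * (Real.exp ρ - 1) := by
  have hρ : 0 ≤ ρ := (abs_nonneg s).trans hs
  have h1 : Real.exp s ≤ Real.exp ρ := Real.exp_le_exp.2 (abs_le.1 hs).2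
  have h2 : Real.exp (-s) ≤ Real.exp ρ := Real.exp_le_exp.2 (by linarith [(abs_le.1 hs).1])
  have h3 : Real.exp (-ρ) ≤ Real.exp s := Real.exp_le_exp.2 (abs_le.1 hs).1
  have h4 : Real.exp (-ρ) ≤ Real.exp (-s) := Real.exp_le_exp.2 (by linarith [(abs_le.1 hs).2])
  have h5 : 2 ≤ Real.exp ρ + Real.exp (-ρ) := by
    have := Real.add_one_le_exp ρ
    have := Real.one_le_cosh ρ
    rw [Real.cosh_eq] at this
    linarith
  rw [abs_le]
  constructor <;> linarith

theorem sum_norm_hamMatrix_exp_le (V : Zd d → ℝ) (E : ℝ) (Θ : Finset (Zd d)) (u : Zd d) {ρ : ℝ}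
    (hρ : 0 ≤ ρ) (x : Θ) :
    ∑ y : Θ, ‖hamMatrix V E Θ x y‖ *
      |Real.exp (ρ * ‖(x : Zd d) - u‖) / Real.exp (ρ * ‖(y : Zd d) - u‖) -
        Real.exp (ρ * ‖(y : Zd d) - u‖) / Real.exp (ρ * ‖(x : Zd d) - u‖)| ≤
      4 * d * (Real.exp ρ - 1) := by
  have h := sum_norm_hamMatrix_mul_le V E Θ
    (g := fun y => |Real.exp (ρ * ‖(x : Zd d) - u‖) / Real.exp (ρ * ‖(y : Zd d) - u‖) -
        Real.exp (ρ * ‖(y : Zd d) - u‖) / Real.exp (ρ * ‖(x : Zd d) - u‖)|)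
    (fun _ => abs_nonneg _) x (by simp) (K := 2 * (Real.exp ρ - 1)) (fun y hy => ?_)
  · refine h.trans (le_of_eq (by ring))
  · simp only [← Real.exp_sub]
    have := abs_exp_sub_exp_neg_le (s := ρ * ‖(x : Zd d) - u‖ - ρ * ‖y - u‖) (ρ := ρ) (by
      rw [← mul_sub, abs_mul, abs_of_nonneg hρ]
      refine mul_le_of_le_one_right hρ ?_
      refine (abs_norm_sub_norm_le _ _).trans ?_
      rw [sub_sub_sub_cancel_right, norm_sub_rev]
      exact hy)
    rwa [neg_sub] at this

/-! ### Generalized eigenfunctions -/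

theorem finsum_shift_single (ψ : Zd d → ℂ) (x t : Zd d) :
    ∑ᶠ z, (Pi.single x 1 : Zd d → ℂ) (z + t) * ψ z = ψ (x - t) := by
  rw [finsum_eq_single _ (x - t)]
  · simp
  · intro z hz
    rw [Pi.single_eq_of_ne, zero_mul]
    rintro rfl
    exact hz (by simp)

theorem IsGenEigenfunction.schrodinger_eq {V : Zd d → ℝ} {lam : ℝ} {ψ : Zd d → ℂ}
    (h : IsGenEigenfunction V lam ψ) (x : Zd d) : schrodinger V ψ x = lam * ψ x := by
  have hfin : ∀ (t : Zd d) (c : Zd d → ℂ),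
      (Function.support fun z => (Pi.single x 1 : Zd d → ℂ) (z + t) * c z).Finite := by
    intro t c
    refine (Set.finite_singleton (x - t)).subset fun z hz => ?_
    by_contra hne
    refine hz ?_
    have : z + t ≠ x := fun h' => hne (by simp [← h'])
    simp [Pi.single_eq_of_ne this]
  have h1 := h.2 (Pi.single x 1) ((Set.finite_singleton x).subset Pi.support_single_subset)
  have h2 : ∀ z, (starRingEnd ℂ) (schrodinger V (Pi.single x 1) z -
      (lam : ℂ) * (Pi.single x 1 : Zd d → ℂ) z) * ψ z =
      -∑ i : Fin d, ((Pi.single x 1 : Zd d → ℂ) (z + Pi.single i 1) * ψ z +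
        (Pi.single x 1 : Zd d → ℂ) (z + -Pi.single i 1) * ψ z) +
      (Pi.single x 1 : Zd d → ℂ) (z + 0) * (((V z : ℂ) - lam) * ψ z) := by
    intro z
    have hs : ∀ t : Zd d, (starRingEnd ℂ) ((Pi.single x 1 : Zd d → ℂ) t) =
        (Pi.single x 1 : Zd d → ℂ) t := by
      intro t
      rw [Pi.single_apply]
      split_ifs <;> simp
    simp only [schrodinger, laplacian, map_sub, map_add, map_neg, map_sum, map_mul, hs,
      Complex.conj_ofReal, ← add_mul, ← Finset.sum_mul, add_zero, ← sub_eq_add_neg]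
    ring
  simp only [h2] at h1
  have hs : (Function.support fun z => ∑ i : Fin d,
      ((Pi.single x 1 : Zd d → ℂ) (z + Pi.single i 1) * ψ z +
        (Pi.single x 1 : Zd d → ℂ) (z + -Pi.single i 1) * ψ z)).Finite := by
    refine ((Set.finite_iUnion fun i : Fin d => (hfin (Pi.single i 1) ψ).union
      (hfin (-Pi.single i 1) ψ))).subset fun z hz => ?_
    obtain ⟨i, _, hi⟩ := Finset.exists_ne_zero_of_sum_ne_zero hz
    refine Set.mem_iUnion.2 ⟨i, ?_⟩
    by_contra hc
    simp only [Set.mem_union, Function.mem_support, not_or, not_not] at hc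
    exact hi (by rw [hc.1, hc.2, add_zero])
  rw [finsum_add_distrib (by
      simpa [Function.HasFiniteSupport, Function.support_neg] using hs) (hfin 0 _),
    finsum_neg_distrib, finsum_sum_comm] at h1
  · have h3 : ∀ i : Fin d, ∑ᶠ z, ((Pi.single x 1 : Zd d → ℂ) (z + Pi.single i 1) * ψ z +
        (Pi.single x 1 : Zd d → ℂ) (z + -Pi.single i 1) * ψ z) =
        ψ ((x : Zd d) + Pi.single i 1) + ψ ((x : Zd d) - Pi.single i 1) := by
      intro i
      rw [finsum_add_distrib (hfin _ _) (hfin _ _), finsum_shift_single, finsum_shift_single,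
        sub_neg_eq_add, add_comm]
    simp only [h3] at h1
    rw [finsum_shift_single (fun z => ((V z : ℂ) - lam) * ψ z) x 0, sub_zero] at h1
    unfold schrodinger laplacian
    linear_combination h1
  · intro i _
    exact ((hfin (Pi.single i 1) ψ).union (hfin (-Pi.single i 1) ψ)).subset
      (Function.support_add _ _)

theorem one_le_jap (x : Zd d) : 1 ≤ jap x := by
  unfold jap
  rw [Real.one_le_sqrt]
  nlinarith [sq_nonneg ‖x‖]

theorem jap_pos (x : Zd d) : 0 < jap x := zero_lt_one.trans_le (one_le_jap x)

theorem jap_le_mul (x a : Zd d) : jap x ≤ 2 * jap a * jap (x - a) := by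
  unfold jap
  have h : ‖x‖ ≤ ‖x - a‖ + ‖a‖ := by simpa using norm_add_le (x - a) a
  refine Real.sqrt_le_iff.2 ⟨by positivity, ?_⟩
  rw [mul_pow, mul_pow, Real.sq_sqrt (by positivity), Real.sq_sqrt (by positivity)]
  have h2 : ‖x‖ ^ 2 ≤ (‖x - a‖ + ‖a‖) ^ 2 := by gcongr
  nlinarith [sq_nonneg (‖x - a‖ - ‖a‖), mul_nonneg (sq_nonneg ‖a‖) (sq_nonneg ‖x - a‖),
    sq_nonneg ‖a‖, sq_nonneg ‖x - a‖]

theorem summable_Tinv {ν : ℝ} (hν : 0 ≤ ν) {ψ : Zd d → ℂ}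
    (h : Summable fun x => ‖Tinv ν 0 ψ x‖ ^ 2) (a : Zd d) :
    Summable fun x => ‖Tinv ν a ψ x‖ ^ 2 := by
  refine Summable.of_nonneg_of_le (fun _ => sq_nonneg _) (fun x => ?_)
    (h.mul_left (((2 * jap a) ^ ν) ^ 2))
  rw [← mul_pow]
  refine pow_le_pow_left₀ (norm_nonneg _) ?_ 2
  have hx := jap_pos x
  have hxa := jap_pos (x - a)
  have ha := jap_pos a
  unfold Tinv
  rw [norm_mul, norm_mul, Complex.norm_real, Complex.norm_real, sub_zero, ← mul_assoc,
    Real.norm_of_nonneg (by positivity), Real.norm_of_nonneg (by positivity)]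
  refine mul_le_mul_of_nonneg_right ?_ (norm_nonneg _)
  rw [← div_eq_mul_inv, le_div_iff₀ (by positivity), inv_mul_le_iff₀ (by positivity),
    ← Real.mul_rpow (by positivity) (by positivity)]
  refine Real.rpow_le_rpow hx.le ?_ hν
  linarith [jap_le_mul x a]

theorem norm_le_jap_mul_l2norm {ν : ℝ} {a : Zd d} {ψ : Zd d → ℂ}
    (h : Summable fun x => ‖Tinv ν a ψ x‖ ^ 2) (x : Zd d) :
    ‖ψ x‖ ≤ jap (x - a) ^ ν * l2norm (Tinv ν a ψ) := by
  have hx := jap_pos (x - a)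
  have h1 : ‖Tinv ν a ψ x‖ ≤ l2norm (Tinv ν a ψ) :=
    Real.le_sqrt_of_sq_le (h.le_tsum x fun _ _ => sq_nonneg _)
  have h2 : ‖ψ x‖ = jap (x - a) ^ ν * ‖Tinv ν a ψ x‖ := by
    unfold Tinv
    rw [norm_mul, Complex.norm_real, Real.norm_of_nonneg (by positivity), ← mul_assoc,
      mul_inv_cancel₀ (by positivity), one_mul]
  rw [h2]
  gcongr

/-- A bound for all generalized eigenfunctions is a bound for `W`. -/
theorem W_le_of_forall {ν lam : ℝ} (hν : 0 ≤ ν) {V : Zd d → ℝ} {a b : Zd d} {B : ℝ} (hB : 0 ≤ B)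
    (h : ∀ ψ : Zd d → ℂ, (∀ x, schrodinger V ψ x = lam * ψ x) →
      (∀ x, ‖ψ x‖ ≤ jap (x - a) ^ ν * l2norm (Tinv ν a ψ)) →
      ‖ψ b‖ ≤ B * l2norm (Tinv ν a ψ)) : W ν V lam a b ≤ B := by
  refine Real.iSup_le (fun ψ => ?_) hB
  refine div_le_of_le_mul₀ (Real.sqrt_nonneg _) hB ?_
  exact h ψ ψ.2.1.schrodinger_eq (norm_le_jap_mul_l2norm (summable_Tinv hν ψ.2.2 a))

theorem W_le_jap {ν lam : ℝ} (hν : 0 ≤ ν) {V : Zd d → ℝ} (a b : Zd d) :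
    W ν V lam a b ≤ jap (b - a) ^ ν :=
  W_le_of_forall hν (Real.rpow_nonneg (jap_pos _).le _) fun _ _ h => h b

theorem W_nonneg {ν lam : ℝ} {V : Zd d → ℝ} (a b : Zd d) : 0 ≤ W ν V lam a b :=
  Real.iSup_nonneg fun _ => div_nonneg (norm_nonneg _) (Real.sqrt_nonneg _)

/-! ### Decay in a localizing box -/

/-- The boundary term of the restriction of `ψ` to `Θ`. -/
noncomputable def boundaryTerm (Θ : Finset (Zd d)) (ψ : Zd d → ℂ) (x : Zd d) : ℂ :=
  laplacian (fun z => if z ∈ Θ then 0 else ψ z) x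

theorem hamMatrix_restrict {V : Zd d → ℝ} {lam : ℝ} {ψ : Zd d → ℂ}
    (h : ∀ x, schrodinger V ψ x = lam * ψ x) (E : ℝ) (Θ : Finset (Zd d)) (x : Θ) :
    ∑ y, hamMatrix V E Θ x y * ψ y = ((lam - E : ℝ) : ℂ) * ψ x + boundaryTerm Θ ψ x := by
  have hz : ∀ z, extendZero Θ (fun y : Θ => ψ y) z = ψ z - if z ∈ Θ then 0 else ψ z := by
    intro z
    unfold extendZero
    split_ifs <;> simp
  have h1 := h x
  rw [sum_hamMatrix_mul V E Θ (fun y : Θ => ψ y) x]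
  unfold boundaryTerm
  unfold schrodinger laplacian at *
  simp only [hz]
  have h2 : ∑ i : Fin d, ((ψ ((x : Zd d) + Pi.single i 1) - if (x : Zd d) + Pi.single i 1 ∈ Θ then 0 else ψ ((x : Zd d) + Pi.single i 1)) +
      (ψ ((x : Zd d) - Pi.single i 1) - if (x : Zd d) - Pi.single i 1 ∈ Θ then 0 else ψ ((x : Zd d) - Pi.single i 1))) =
      ∑ i : Fin d, (ψ ((x : Zd d) + Pi.single i 1) + ψ ((x : Zd d) - Pi.single i 1)) -
      ∑ i : Fin d, ((if (x : Zd d) + Pi.single i 1 ∈ Θ then 0 else ψ ((x : Zd d) + Pi.single i 1)) +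
        (if (x : Zd d) - Pi.single i 1 ∈ Θ then 0 else ψ ((x : Zd d) - Pi.single i 1))) := by
    rw [← Finset.sum_sub_distrib]
    exact Finset.sum_congr rfl fun i _ => by ring
  rw [h2, if_pos x.2]
  push_cast
  linear_combination h1

theorem norm_boundaryTerm_le {Θ : Finset (Zd d)} {ψ : Zd d → ℂ} {x : Zd d} {M : ℝ} (hM : 0 ≤ M)
    (h : ∀ z, ‖z - x‖ ≤ 1 → z ∉ Θ → ‖ψ z‖ ≤ M) : ‖boundaryTerm Θ ψ x‖ ≤ 2 * d * M := by
  have h1 : ∀ z, ‖z - x‖ ≤ 1 → ‖if z ∈ Θ then 0 else ψ z‖ ≤ M := by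
    intro z hz
    split_ifs with hzΘ
    · simpa using hM
    · exact h z hz hzΘ
  unfold boundaryTerm laplacian
  refine (norm_sum_le _ _).trans ?_
  calc _ ≤ ∑ _i : Fin d, (M + M) := by
        refine Finset.sum_le_sum fun i _ => (norm_add_le _ _).trans
          (add_le_add (h1 _ ?_) (h1 _ ?_)) <;> simp [norm_unit]
    _ = 2 * d * M := by
        simp
        ring

theorem boundaryTerm_eq_zero {Θ : Finset (Zd d)} {ψ : Zd d → ℂ} {x : Zd d}
    (h : ∀ z, ‖z - x‖ ≤ 1 → z ∈ Θ) : boundaryTerm Θ ψ x = 0 := by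
  unfold boundaryTerm laplacian
  refine Finset.sum_eq_zero fun i _ => ?_
  simp only [h (x + Pi.single i 1) (by simp [norm_unit]), h (x - Pi.single i 1) (by simp [norm_unit]),
    if_true, add_zero]

theorem sum_star_mul_hermitian {ι : Type*} [Fintype ι] {H : Matrix ι ι ℂ} (hH : H.IsHermitian)
    {φ : ι → ℂ} {t : ℝ} (hφ : ∀ x, ∑ y, H x y * φ y = t * φ x) (ψ : ι → ℂ) :
    ∑ x, star (φ x) * ∑ y, H x y * ψ y = t * ∑ u, star (φ u) * ψ u := by
  simp only [Finset.mul_sum]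
  rw [Finset.sum_comm]
  refine Finset.sum_congr rfl fun y _ => ?_
  have h3 := congrArg star (hφ y)
  have h3' : star ((t : ℂ)) = t := Complex.conj_ofReal _
  rw [star_sum, star_mul, h3'] at h3
  calc _ = (∑ x, star (H y x * φ x)) * ψ y := by
        rw [Finset.sum_mul]
        refine Finset.sum_congr rfl fun x _ => ?_
        rw [star_mul, ← hH.apply x y]
        ring
    _ = _ := by
        rw [h3]
        ring

theorem restrict_eq_sum_resolvent {ι : Type*} [Fintype ι]
    (φ : OrthonormalBasis ι ℂ (EuclideanSpace ℂ ι)) (H : Matrix ι ι ℂ) (hH : H.IsHermitian)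
    {θ : ι → ℝ} (hφ : ∀ j x, ∑ y, H x y * φ j y = θ j * φ j x) {lam : ℝ}
    (hlam : ∀ j, θ j ≠ lam) {ψ g : ι → ℂ} (hψ : ∀ x, ∑ y, H x y * ψ y = lam * ψ x + g x) (y : ι) :
    ψ y = ∑ u, specSum φ (fun j => (θ j - lam)⁻¹) u y * g u := by
  have hR : ∑ u, specSum φ (fun j => (θ j - lam)⁻¹) u y * g u =
      ∑ j, ∑ u, (((θ j - lam)⁻¹ : ℝ) : ℂ) * (φ j y * star (φ j u)) * g u := by
    simp only [specSum, Finset.sum_mul]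
    exact Finset.sum_comm
  rw [eigenbasis_expansion φ ψ y, hR]
  refine Finset.sum_congr rfl fun j _ => ?_
  have h1 : ∑ u, star (φ j u) * g u = (θ j - lam) * ∑ u, star (φ j u) * ψ u := by
    have h2 := sum_star_mul_hermitian hH (hφ j) ψ
    simp only [hψ, mul_add, Finset.sum_add_distrib] at h2
    have h4 : ∑ x, star (φ j x) * (lam * ψ x) = lam * ∑ u, star (φ j u) * ψ u := by
      rw [Finset.mul_sum]
      exact Finset.sum_congr rfl fun x _ => by ring
    rw [h4] at h2
    linear_combination h2
  have h5 : ((θ j : ℂ) - lam) ≠ 0 := by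
    exact_mod_cast sub_ne_zero.2 (hlam j)
  calc (∑ u, star (φ j u) * ψ u) * φ j y
      = (((θ j : ℂ) - lam)⁻¹ * ∑ u, star (φ j u) * g u) * φ j y := by
        rw [h1]
        field_simp
    _ = _ := by
        rw [Finset.mul_sum, Finset.sum_mul]
        push_cast
        exact Finset.sum_congr rfl fun u _ => by ring

end Lattice

section BoxDecay

variable {d : ℕ}

theorem IsEigenpair.hamMatrix_mul {V : Zd d → ℝ} {Θ : Finset (Zd d)} {φ : EuclideanSpace ℂ Θ}
    {t : ℝ} (h : IsEigenpair V Θ φ t) (E : ℝ) (x : Θ) :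
    ∑ y, hamMatrix V E Θ x y * φ y = ((t - E : ℝ) : ℂ) * φ x := by
  rw [sum_hamMatrix_mul, h.2 x]
  push_cast
  ring

theorem norm_apply_le_norm {ι : Type*} [Fintype ι] (φ : EuclideanSpace ℂ ι) (x : ι) :
    ‖φ x‖ ≤ ‖φ‖ :=
  PiLp.norm_apply_le φ x

theorem norm_mul_norm_le_of_localized {τ L : ℝ} {c : Fin d → ℝ}
    {φ : EuclideanSpace ℂ (box L c)} {x : Zd d} {m r : ℝ} (hL : 0 ≤ L ^ τ) (hm : 0 ≤ m)
    (h : IsLocalizedAt τ L c φ x m) {y u : box L c} (hyu : 2 * L ^ τ ≤ ‖(y : Zd d) - u‖)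
    (hr : r + L ^ τ ≤ ‖(y : Zd d) - u‖) :
    ‖φ y‖ * ‖φ u‖ ≤ Real.exp (-(m * r)) := by
  have hl : (⌊L ^ τ⌋₊ : ℝ) ≤ L ^ τ := Nat.floor_le hL
  have htri : ‖(y : Zd d) - u‖ ≤ ‖(y : Zd d) - x‖ + ‖(u : Zd d) - x‖ := by
    rw [norm_sub_rev (u : Zd d) x]
    simpa using norm_add_le ((y : Zd d) - x) (x - u)
  have hy1 : ‖φ y‖ ≤ 1 := (norm_apply_le_norm φ y).trans h.1.le
  have hu1 : ‖φ u‖ ≤ 1 := (norm_apply_le_norm φ u).trans h.1.le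
  by_cases h1 : (⌊L ^ τ⌋₊ : ℝ) ≤ ‖(y : Zd d) - x‖
  · have hy := h.2 y h1
    by_cases h2 : (⌊L ^ τ⌋₊ : ℝ) ≤ ‖(u : Zd d) - x‖
    · refine (mul_le_mul hy (h.2 u h2) (norm_nonneg _) (Real.exp_pos _).le).trans ?_
      rw [← Real.exp_add, Real.exp_le_exp]
      nlinarith
    · refine (mul_le_mul hy hu1 (norm_nonneg _) (Real.exp_pos _).le).trans ?_
      rw [mul_one, Real.exp_le_exp]
      push Not at h2
      nlinarith
  · push Not at h1
    have h2 : (⌊L ^ τ⌋₊ : ℝ) ≤ ‖(u : Zd d) - x‖ := by linarith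
    refine (mul_le_mul hy1 (h.2 u h2) (norm_nonneg _) zero_le_one).trans ?_
    rw [one_mul, Real.exp_le_exp]
    nlinarith

/-- Decay of solutions of `H ψ = λ ψ` inside a box with localized eigenfunctions. -/
theorem norm_le_of_localized_basis (hd : 1 ≤ d) {V : Zd d → ℝ} {τ L : ℝ} {c : Fin d → ℝ}
    {m E A : ℝ} (hL : 0 ≤ L) (hA : 0 < A) (hm : 0 < m)
    (hmA : m ≤ 1 / 2 * Real.log (1 + A / (4 * d)))
    {φ : OrthonormalBasis (box L c) ℂ (EuclideanSpace ℂ (box L c))} {θ : box L c → ℝ}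
    (hφ : ∀ j, IsEigenpair V (box L c) (φ j) (θ j) ∧
      ∃ x ∈ box L c, IsLocalizedAt τ L c (φ j) x (m * hI E A (θ j)))
    {lam δ r M : ℝ} (hlam : |lam - E| < A) (hδ : 0 < δ) (hgap : ∀ j, δ ≤ |θ j - lam|)
    (hr : L ^ τ ≤ r) (hp : 1 ≤ m * r) {ψ : Zd d → ℂ}
    (hψ : ∀ x, schrodinger V ψ x = lam * ψ x) (hM0 : 0 ≤ M)
    (hM : ∀ v, ‖toR v - c‖ ≤ L / 2 + 1 → ‖ψ v‖ ≤ M) {y : Zd d}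
    (hy : ‖toR y - c‖ + (r + L ^ τ + 1) ≤ L / 2) :
    ‖ψ y‖ ≤ (box L c).card * (((3 * (box L c).card / δ + 240 / A) *
      Real.exp (-(m * r * hI E A lam))) * (2 * d * M)) := by
  have hLτ : 0 ≤ L ^ τ := Real.rpow_nonneg hL _
  have hd0 : (0 : ℝ) < d := by exact_mod_cast hd
  have hyB : y ∈ box L c := mem_box.2 (by linarith)
  have hexp : 4 * d * (Real.exp (2 * m) - 1) ≤ A := by
    have h1 : Real.exp (2 * m) ≤ 1 + A / (4 * d) := by
      rw [← Real.le_log_iff_exp_le (by positivity)]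
      linarith
    have h2 : Real.exp (2 * m) - 1 ≤ A / (4 * d) := by linarith
    rw [le_div_iff₀ (by positivity)] at h2
    linarith
  have hlamA : |(lam - E) / A| < 1 := by
    rw [abs_div, abs_of_pos hA, div_lt_one hA]
    exact hlam
  have heq : ∀ j x, ∑ z, hamMatrix V E (box L c) x z * φ j z = ((θ j - E : ℝ) : ℂ) * φ j x :=
    fun j x => (hφ j).1.hamMatrix_mul E x
  have hne : ∀ j, θ j - E ≠ lam - E := by
    intro j h
    have := hgap j
    rw [show θ j - lam = 0 by linarith, abs_zero] at this
    linarith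
  have hrep := restrict_eq_sum_resolvent φ (hamMatrix V E (box L c)) (hamMatrix_isHermitian V E (box L c)) heq hne
    (ψ := fun z : (box L c) => ψ z) (g := fun z : (box L c) => boundaryTerm (box L c) ψ z)
    (fun x => hamMatrix_restrict hψ E (box L c) x) ⟨y, hyB⟩
  simp only at hrep
  rw [hrep]
  refine (norm_sum_le _ _).trans ?_
  set B := (3 * ((box L c).card : ℝ) / δ + 240 / A) * Real.exp (-(m * r * hI E A lam)) * (2 * d * M) with hB
  have hB0 : 0 ≤ B := by positivity
  have hterm : ∀ u ∈ (Finset.univ : Finset (box L c)),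
      ‖specSum φ (fun j => (θ j - E - (lam - E))⁻¹) u ⟨y, hyB⟩ * boundaryTerm (box L c) ψ u‖ ≤ B := by
    intro u _
    by_cases hu : ∀ z : Zd d, ‖z - u‖ ≤ 1 → z ∈ (box L c)
    · rw [boundaryTerm_eq_zero hu, mul_zero, norm_zero]
      exact hB0
    push Not at hu
    obtain ⟨v, hvu, hvB⟩ := hu
    have huB : ‖toR (u : Zd d) - c‖ ≤ L / 2 := mem_box.1 u.2
    have hdist : r + L ^ τ ≤ ‖y - u‖ := by
      have h1 : L / 2 < ‖toR v - c‖ := by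
        by_contra h
        exact hvB (mem_box.2 (not_lt.1 h))
      have h2 : ‖toR v - c‖ ≤ ‖toR v - toR (u : Zd d)‖ + ‖toR (u : Zd d) - toR y‖ +
          ‖toR y - c‖ := by
        have := norm_add₃_le (a := toR v - toR (u : Zd d)) (b := toR (u : Zd d) - toR y)
          (c := toR y - c)
        simpa using this
      rw [norm_toR_sub, norm_toR_sub, norm_sub_rev (u : Zd d) y] at h2
      linarith
    have hbd : ‖boundaryTerm (box L c) ψ u‖ ≤ 2 * d * M := by
      refine norm_boundaryTerm_le hM0 fun z hz _ => hM z ?_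
      have h2 : ‖toR z - c‖ ≤ ‖toR z - toR (u : Zd d)‖ + ‖toR (u : Zd d) - c‖ := by
        simpa using norm_add_le (toR z - toR (u : Zd d)) (toR (u : Zd d) - c)
      rw [norm_toR_sub] at h2
      linarith
    have hres := norm_resolvent_le_exp φ (hamMatrix V E (box L c)) (hamMatrix_isHermitian V E (box L c))
      (fun x => Real.exp (2 * m * ‖(x : Zd d) - u‖)) (fun _ => Real.exp_pos _) hA
      (fun x => (sum_norm_hamMatrix_exp_le V E (box L c) u (by positivity) x).trans hexp) heq hlam hδ
      (fun j => by simpa using hgap j) hp (u := u) (y := ⟨y, hyB⟩) (by simp)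
      (Real.exp_le_exp.2 (by nlinarith)) (fun j => by
        obtain ⟨x, _, hx⟩ := (hφ j).2
        refine (norm_mul_norm_le_of_localized (r := r) hLτ
          (mul_nonneg hm.le (hfun_nonneg _)) hx (y := ⟨y, hyB⟩) (u := u) ?_ hdist).trans
          (Real.exp_le_exp.2 (le_of_eq ?_))
        · change 2 * L ^ τ ≤ ‖y - u‖
          linarith
        · ring_nf)
    rw [← hfun_of_abs_lt hlamA, Fintype.card_coe] at hres
    rw [norm_mul, hB]
    exact mul_le_mul hres hbd (norm_nonneg _) (by positivity)
  refine (Finset.sum_le_sum hterm).trans (le_of_eq ?_)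
  rw [Finset.sum_const, Finset.card_univ, Fintype.card_coe, nsmul_eq_mul]

theorem card_box_le {L : ℝ} (hL : 0 ≤ L) (c : Fin d → ℝ) : ((box L c).card : ℝ) ≤ (L + 1) ^ d := by
  have hsub : box L c ⊆
      Fintype.piFinset fun i : Fin d => Finset.Icc ⌈c i - L / 2⌉ ⌊c i + L / 2⌋ := by
    intro y hy
    refine Fintype.mem_piFinset.2 fun i => ?_
    have h : |(y i : ℝ) - c i| ≤ L / 2 := (norm_le_pi_norm (toR y - c) i).trans (mem_box.1 hy)
    rw [abs_le] at h
    exact Finset.mem_Icc.2 ⟨Int.ceil_le.2 (by linarith), Int.le_floor.2 (by linarith)⟩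
  calc ((box L c).card : ℝ)
      ≤ ∏ i : Fin d, ((Finset.Icc ⌈c i - L / 2⌉ ⌊c i + L / 2⌋).card : ℝ) := by
        have := Finset.card_le_card hsub
        rw [Fintype.card_piFinset] at this
        exact_mod_cast this
    _ ≤ ∏ _i : Fin d, (L + 1) := by
        refine Finset.prod_le_prod (fun _ _ => by positivity) fun i _ => ?_
        rw [Int.card_Icc]
        have h1 := Int.floor_le (c i + L / 2)
        have h2 := Int.le_ceil (c i - L / 2)
        rw [← Int.cast_natCast, Int.toNat_eq_max, Int.cast_max]
        refine max_le ?_ (by push_cast; linarith)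
        push_cast
        linarith
    _ = (L + 1) ^ d := by simp

/-! ### Large scales -/

/-- The inequalities that make a scale large enough for the deterministic estimates. -/
structure IsLargeScale (d : ℕ) (ν : ℝ) {ξ ζ : ℝ} (e : Exponents ξ ζ) (L : ℝ) : Prop where
  three_le : 3 ≤ L
  prefactor : (L + 1) ^ d * ((6 * (L + 1) ^ d * Real.exp (L ^ e.β) + 240 * L) *
    (2 * d * (4 * L) ^ ν)) ≤ Real.exp (2 * L ^ e.β)
  gap : 2 * L ^ e.β * L ^ (e.κ + e.κ') ≤ L / 56 - 1 - L ^ e.τ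
  wegner : 2 * Real.exp (-L ^ e.β) * (L + 1) ^ d ≤ 1

theorem eventually_mul_rpow_le_exp_rpow (C s : ℝ) {β : ℝ} (hβ : 0 < β) :
    ∀ᶠ L : ℝ in Filter.atTop, C * L ^ s ≤ Real.exp (L ^ β) := by
  have h := ((isLittleO_rpow_exp_atTop (s / β)).const_mul_left C).comp_tendsto
    (tendsto_rpow_atTop hβ)
  filter_upwards [h.bound zero_lt_one, Filter.eventually_ge_atTop 0] with L hL hL0
  simp only [Function.comp, one_mul, Real.norm_eq_abs, Real.abs_exp] at hL
  rw [← Real.rpow_mul hL0, mul_div_cancel₀ _ hβ.ne'] at hL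
  exact (le_abs_self _).trans hL

theorem eventually_mul_rpow_le_self (C : ℝ) {s : ℝ} (hs : s < 1) :
    ∀ᶠ L : ℝ in Filter.atTop, C * L ^ s ≤ L := by
  have h := (tendsto_rpow_atTop (sub_pos.2 hs)).eventually_ge_atTop C
  filter_upwards [h, Filter.eventually_gt_atTop 0] with L hL hL0
  calc C * L ^ s ≤ L ^ (1 - s) * L ^ s := by gcongr
    _ = L := by
      rw [← Real.rpow_add hL0]
      simp

theorem Exponents.β_pos {ξ ζ : ℝ} (e : Exponents ξ ζ) : 0 < e.β :=
  (e.ξ_pos.trans e.ξ_lt_ζ).trans e.ζ_lt_β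

theorem Exponents.sum_lt_one {ξ ζ : ℝ} (e : Exponents ξ ζ) : e.β + (e.κ + e.κ') < 1 := by
  have h1 : e.β ≤ e.γ * e.β := le_mul_of_one_le_left e.β_pos.le e.one_lt_γ.le
  linarith [e.κ_add_κ', e.τ_lt_one]

theorem eventually_isLargeScale (d : ℕ) (ν : ℝ) {ξ ζ : ℝ} (e : Exponents ξ ζ) :
    ∀ᶠ L : ℝ in Filter.atTop, IsLargeScale d ν e L := by
  filter_upwards [Filter.eventually_ge_atTop 224, eventually_mul_rpow_le_self 448 e.sum_lt_one,
    eventually_mul_rpow_le_self 224 e.τ_lt_one,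
    eventually_mul_rpow_le_exp_rpow (2 ^ d * (480 * d * 4 ^ ν) * 2) (d + 1 + ν) e.β_pos,
    eventually_mul_rpow_le_exp_rpow (2 * (2 ^ d * (6 * 2 ^ d * (2 * d * 4 ^ ν)))) (d + d + ν)
      e.β_pos,
    eventually_mul_rpow_le_exp_rpow (2 * 2 ^ d) d e.β_pos] with L h1 h2 h3 h5 h4 h6
  have hL0 : 0 < L := by linarith
  have hpow : (L + 1) ^ d ≤ 2 ^ d * L ^ (d : ℝ) := by
    rw [Real.rpow_natCast, ← mul_pow]
    gcongr
    linarith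
  have hexp1 : 1 ≤ Real.exp (L ^ e.β) := Real.one_le_exp (by positivity)
  refine ⟨by linarith, ?_, ?_, ?_⟩
  · rw [Real.mul_rpow (by norm_num) hL0.le, show 2 * L ^ e.β = L ^ e.β + L ^ e.β by ring,
      Real.exp_add]
    set X := Real.exp (L ^ e.β) with hX
    calc (L + 1) ^ d * ((6 * (L + 1) ^ d * X + 240 * L) * (2 * d * (4 ^ ν * L ^ ν)))
        ≤ (2 ^ d * L ^ (d : ℝ)) * ((6 * (2 ^ d * L ^ (d : ℝ)) * X + 240 * (L * X)) *
          (2 * d * (4 ^ ν * L ^ ν))) := by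
          gcongr
          exact le_mul_of_one_le_right hL0.le hexp1
      _ = (1 / 2 * (2 * (2 ^ d * (6 * 2 ^ d * (2 * d * 4 ^ ν))) * L ^ ((d : ℝ) + d + ν)) +
          1 / 2 * (2 ^ d * (480 * d * 4 ^ ν) * 2 * L ^ ((d : ℝ) + 1 + ν))) * X := by
          rw [Real.rpow_add hL0, Real.rpow_add hL0, Real.rpow_add hL0, Real.rpow_add hL0,
            Real.rpow_one]
          ring
      _ ≤ (1 / 2 * X + 1 / 2 * X) * X := by gcongr
      _ = X * X := by ring
  · rw [mul_assoc, ← Real.rpow_add hL0]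
    linarith
  · rw [Real.exp_neg, mul_comm, ← mul_assoc, ← div_eq_mul_inv, div_le_one (Real.exp_pos _)]
    linarith

theorem IsLargeScale.weight {ν ξ ζ L : ℝ} {e : Exponents ξ ζ} (hd : 1 ≤ d)
    (h : IsLargeScale d ν e L) : (4 * L) ^ ν ≤ Real.exp (2 * L ^ e.β) := by
  have hL := h.three_le
  refine le_trans ?_ h.prefactor
  have h1 : (1 : ℝ) ≤ (L + 1) ^ d := one_le_pow₀ (by linarith)
  have hd1 : (1 : ℝ) ≤ d := by exact_mod_cast hd
  have h2 : 0 ≤ (4 * L) ^ ν := by positivity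
  have h3 : (4 * L) ^ ν ≤ 2 * d * (4 * L) ^ ν := by nlinarith
  have h4 : 0 ≤ 6 * (L + 1) ^ d * Real.exp (L ^ e.β) := by positivity
  calc (4 * L) ^ ν ≤ 1 * (1 * (2 * d * (4 * L) ^ ν)) := by linarith
    _ ≤ _ := by
      gcongr
      linarith

theorem jap_le_four_mul {L : ℝ} (hL : 1 ≤ L) {x : Zd d} (hx : ‖x‖ ≤ 3 * L) : jap x ≤ 4 * L := by
  unfold jap
  refine Real.sqrt_le_iff.2 ⟨by linarith, ?_⟩
  have : ‖x‖ ^ 2 ≤ (3 * L) ^ 2 := by gcongr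
  nlinarith

theorem radiusUp_pos {κ A L : ℝ} (hκ : 0 < κ) (hA : 0 < A) (hL : 1 < L) :
    0 < radiusUp κ A L := by
  have h : L ^ (-κ) < 1 := Real.rpow_lt_one_of_one_lt_of_neg hL (by linarith)
  have : 0 < 1 - L ^ (-κ) := by linarith
  unfold radiusUp
  positivity

theorem abs_div_radiusUp_lt {κ A L E lam : ℝ} (hκ : 0 < κ) (hA : 0 < A) (hL : 1 < L)
    (hlam : |lam - E| < A) : |(lam - E) / radiusUp κ A L| < 1 - L ^ (-κ) := by
  have h : L ^ (-κ) < 1 := Real.rpow_lt_one_of_one_lt_of_neg hL (by linarith)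
  have h1 : 0 < 1 - L ^ (-κ) := by linarith
  rw [abs_div, abs_of_pos (radiusUp_pos hκ hA hL), div_lt_iff₀ (radiusUp_pos hκ hA hL)]
  unfold radiusUp
  rw [mul_comm A, ← mul_assoc, mul_inv_cancel₀ h1.ne', one_mul]
  exact hlam

theorem rpow_neg_le_hI {κ A L E lam : ℝ} (hκ : 0 < κ) (hA : 0 < A) (hL : 1 < L)
    (hlam : |lam - E| < A) : L ^ (-κ) ≤ hI E (radiusUp κ A L) lam := by
  have h := abs_div_radiusUp_lt hκ hA hL hlam
  have h0 : 0 < L ^ (-κ) := by positivity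
  have h1 := abs_nonneg ((lam - E) / radiusUp κ A L)
  unfold hI
  rw [hfun_of_abs_lt (by linarith), ← sq_abs]
  nlinarith

theorem IsLargeScale.two_mul_rpow_le {ν ξ ζ L : ℝ} {e : Exponents ξ ζ} (h : IsLargeScale d ν e L)
    {x : ℝ} (hx : L ^ (-(e.κ + e.κ')) ≤ x) : 2 * L ^ e.β ≤ x * (L / 56 - 1 - L ^ e.τ) := by
  have hL : 0 < L := by linarith [h.three_le]
  have h1 : 0 < L ^ (-(e.κ + e.κ')) := by positivity
  have h0 : 0 ≤ L / 56 - 1 - L ^ e.τ := le_trans (by positivity) h.gap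
  refine le_trans ?_ (mul_le_mul_of_nonneg_right hx h0)
  refine le_trans (le_of_eq ?_) (mul_le_mul_of_nonneg_left h.gap h1.le)
  rw [mul_comm (L ^ (-(e.κ + e.κ'))), mul_assoc, ← Real.rpow_add hL]
  simp

/-- Decay of `W` inside a localizing box whose spectrum is away from `λ`. -/
theorem W_le_of_localized_basis (hd : 1 ≤ d) {ν : ℝ} (hν : 0 ≤ ν) {ξ ζ : ℝ} {e : Exponents ξ ζ}
    {L : ℝ} (hLs : IsLargeScale d ν e L) {V : Zd d → ℝ} {c : Fin d → ℝ} {m E A : ℝ} (hA : 0 < A)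
    (hm : L ^ (-e.κ') ≤ m) (hmA : m ≤ 1 / 2 * Real.log (1 + radiusUp e.κ A L / (4 * d)))
    {φ : OrthonormalBasis (box L c) ℂ (EuclideanSpace ℂ (box L c))} {θ : box L c → ℝ}
    (hφ : ∀ j, IsEigenpair V (box L c) (φ j) (θ j) ∧
      ∃ x ∈ box L c, IsLocalizedAt e.τ L c (φ j) x (m * hI E (radiusUp e.κ A L) (θ j)))
    {lam q : ℝ} (hlam : |lam - E| < A) (hgap : ∀ j, 1 / 2 * Real.exp (-L ^ e.β) ≤ |θ j - lam|)
    (hq : L / 8 ≤ q) {a y : Zd d} (hca : ‖c - toR a‖ ≤ 2 * L)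
    (hy : ‖toR y - c‖ + q + L / 56 ≤ L / 2) :
    W ν V lam a y ≤ Real.exp (-(m * hI E (radiusUp e.κ A L) lam * q)) := by
  have hL3 := hLs.three_le
  have hL1 : 1 < L := by linarith
  have hL0 : 0 < L := by linarith
  have hκ' : 0 < L ^ (-e.κ') := by positivity
  have hm0 : 0 < m := hκ'.trans_le hm
  set A' := radiusUp e.κ A L with hA'
  have hA'0 : 0 < A' := radiusUp_pos e.κ_pos hA hL1
  set h := hI E A' lam with hh
  have hhL : L ^ (-e.κ) ≤ h := rpow_neg_le_hI e.κ_pos hA hL1 hlam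
  have hh1 : h ≤ 1 := hfun_le_one _
  have hmh : L ^ (-(e.κ + e.κ')) ≤ m * h := by
    rw [neg_add_rev, Real.rpow_add hL0]
    exact mul_le_mul hm hhL (by positivity) hm0.le
  have hgap2 := hLs.two_mul_rpow_le hmh
  have hτ0 : 0 ≤ L ^ e.τ := by positivity
  have hβ1 : 1 ≤ L ^ e.β := Real.one_le_rpow hL1.le e.β_pos.le
  have hgapτ : 0 ≤ L / 56 - 1 - L ^ e.τ := le_trans (by positivity) hLs.gap
  set r := q + L / 56 - 1 - L ^ e.τ with hr
  have hlamA' : |lam - E| < A' := by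
    have := abs_div_radiusUp_lt e.κ_pos hA hL1 hlam
    rw [abs_div, abs_of_pos hA'0, div_lt_iff₀ hA'0] at this
    have h2 : 0 < L ^ (-e.κ) * A' := by positivity
    linarith
  have hd1 : (1 : ℝ) ≤ d := by exact_mod_cast hd
  have hA'L : 1 ≤ L * A' := by
    have h1 : Real.exp (2 * m) ≤ 1 + A' / (4 * d) := by
      rw [← Real.le_log_iff_exp_le (by positivity)]
      linarith
    have h2 := Real.add_one_le_exp (2 * m)
    have h3 : 2 * m ≤ A' / (4 * d) := by linarith
    rw [le_div_iff₀ (by positivity)] at h3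
    have h4 : m ≤ A' := by nlinarith
    have h5 : L ^ (-1 : ℝ) ≤ L ^ (-e.κ') :=
      Real.rpow_le_rpow_of_exponent_le hL1.le (by linarith [e.κ'_lt_one])
    have h6 : L ^ (-1 : ℝ) ≤ A' := by linarith
    rw [Real.rpow_neg_one, inv_le_iff_one_le_mul₀' hL0] at h6
    exact h6
  have hmr : 1 ≤ m * r := by
    have h1 : m * h * (L / 56 - 1 - L ^ e.τ) ≤ m * r := by
      refine mul_le_mul (mul_le_of_le_one_right hm0.le hh1) ?_ hgapτ hm0.le
      linarith
    linarith
  refine W_le_of_forall hν (Real.exp_pos _).le fun ψ hψ hψa => ?_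
  have hN : 0 ≤ l2norm (Tinv ν a ψ) := Real.sqrt_nonneg _
  have hmain := norm_le_of_localized_basis (τ := e.τ) (r := r) (M := (4 * L) ^ ν * l2norm (Tinv ν a ψ))
    hd hL0.le hA'0 hm0 hmA hφ hlamA' (by positivity) hgap (by linarith) hmr hψ
    (by positivity) (fun v hv => ?_) (y := y) (by linarith)
  · refine hmain.trans ?_
    have hcard := card_box_le hL0.le c
    have hpre : 3 * ((box L c).card : ℝ) / (1 / 2 * Real.exp (-L ^ e.β)) + 240 / A' ≤
        6 * (L + 1) ^ d * Real.exp (L ^ e.β) + 240 * L := by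
      refine add_le_add ?_ ?_
      · rw [Real.exp_neg]
        have : 3 * ((box L c).card : ℝ) / (1 / 2 * (Real.exp (L ^ e.β))⁻¹) =
            6 * (box L c).card * Real.exp (L ^ e.β) := by
          field_simp
          ring
        rw [this]
        gcongr
      · rw [div_le_iff₀ hA'0]
        nlinarith
    calc _ ≤ (L + 1) ^ d * (((6 * (L + 1) ^ d * Real.exp (L ^ e.β) + 240 * L) *
            Real.exp (-(m * r * h))) * (2 * d * ((4 * L) ^ ν * l2norm (Tinv ν a ψ)))) := by
          gcongr
      _ = ((L + 1) ^ d * ((6 * (L + 1) ^ d * Real.exp (L ^ e.β) + 240 * L) *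
            (2 * d * (4 * L) ^ ν))) * Real.exp (-(m * r * h)) * l2norm (Tinv ν a ψ) := by ring
      _ ≤ Real.exp (2 * L ^ e.β) * Real.exp (-(m * r * h)) * l2norm (Tinv ν a ψ) := by
          gcongr
          exact hLs.prefactor
      _ ≤ Real.exp (-(m * h * q)) * l2norm (Tinv ν a ψ) := by
          gcongr
          rw [← Real.exp_add, Real.exp_le_exp, hr]
          nlinarith
  · refine (hψa v).trans (mul_le_mul_of_nonneg_right ?_ hN)
    refine Real.rpow_le_rpow (jap_pos _).le (jap_le_four_mul hL1.le ?_) hν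
    have h2 : ‖toR v - toR a‖ ≤ ‖toR v - c‖ + ‖c - toR a‖ := by
      simpa using norm_add_le (toR v - c) (c - toR a)
    rw [norm_toR_sub] at h2
    linarith

end BoxDecay

section Measurability

variable {d : ℕ}

/-! ### Dependence on the potential -/

theorem schrodinger_congr {V V' : Zd d → ℝ} {x : Zd d} (h : V x = V' x) (φ : Zd d → ℂ) :
    schrodinger V φ x = schrodinger V' φ x := by
  unfold schrodinger
  rw [h]

theorem isEigenpair_congr {V V' : Zd d → ℝ} {Θ : Finset (Zd d)} (h : ∀ x ∈ Θ, V x = V' x)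
    (φ : EuclideanSpace ℂ Θ) (t : ℝ) : IsEigenpair V Θ φ t ↔ IsEigenpair V' Θ φ t := by
  unfold IsEigenpair
  simp only [schrodinger_congr (h _ (Subtype.coe_prop _))]

theorem isLocalizingBox_congr {ξ ζ : ℝ} (e : Exponents ξ ζ) {V V' : Zd d → ℝ} {L : ℝ}
    {c : Fin d → ℝ} (h : ∀ x ∈ box L c, V x = V' x) (m E A : ℝ) :
    IsLocalizingBox e V L c m E A ↔ IsLocalizingBox e V' L c m E A := by
  unfold IsLocalizingBox
  simp only [isEigenpair_congr h]

/-- The expectation of `H_Θ` in the state `φ`. -/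
noncomputable def rayleigh (V : Zd d → ℝ) (Θ : Finset (Zd d)) (φ : EuclideanSpace ℂ Θ) : ℝ :=
  (∑ x, star (φ x) * schrodinger V (extendZero Θ φ) x).re

theorem IsEigenpair.rayleigh_eq {V : Zd d → ℝ} {Θ : Finset (Zd d)} {φ : EuclideanSpace ℂ Θ} {t : ℝ}
    (h : IsEigenpair V Θ φ t) : rayleigh V Θ φ = t := by
  have h1 : ∑ x, ‖φ x‖ ^ 2 = 1 := by
    rw [← EuclideanSpace.norm_sq_eq, h.1, one_pow]
  have h2 : ∑ x, star (φ x) * schrodinger V (extendZero Θ φ) x = ((t * ∑ x, ‖φ x‖ ^ 2 : ℝ) : ℂ) := by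
    push_cast
    rw [Finset.mul_sum]
    refine Finset.sum_congr rfl fun x _ => ?_
    rw [h.2 x, ← Complex.conj_mul', Complex.star_def]
    ring
  rw [rayleigh, h2, Complex.ofReal_re, h1, mul_one]

theorem continuous_schrodinger_extendZero (Θ : Finset (Zd d)) (x : Zd d) :
    Continuous fun p : (Zd d → ℝ) × EuclideanSpace ℂ Θ =>
      schrodinger p.1 (extendZero Θ p.2) x := by
  have h : ∀ z, Continuous fun p : (Zd d → ℝ) × EuclideanSpace ℂ Θ => extendZero Θ p.2 z := by
    intro z
    unfold extendZero
    split_ifs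
    · fun_prop
    · fun_prop
  unfold schrodinger laplacian
  have := h
  fun_prop

theorem continuous_rayleigh (Θ : Finset (Zd d)) :
    Continuous fun p : (Zd d → ℝ) × EuclideanSpace ℂ Θ => rayleigh p.1 Θ p.2 := by
  have h := fun x : Zd d => continuous_schrodinger_extendZero Θ x
  unfold rayleigh
  fun_prop

theorem isClosed_isEigenpair (Θ : Finset (Zd d)) :
    IsClosed {p : (Zd d → ℝ) × EuclideanSpace ℂ Θ |
      IsEigenpair p.1 Θ p.2 (rayleigh p.1 Θ p.2)} := by
  have h1 := fun x : Zd d => continuous_schrodinger_extendZero Θ x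
  have h2 := continuous_rayleigh Θ
  unfold IsEigenpair
  simp only [Set.ofPred_and, Set.ofPred_forall]
  refine (isClosed_eq (by fun_prop) (by fun_prop)).inter (isClosed_iInter fun x => ?_)
  exact isClosed_eq (by fun_prop) (by fun_prop)

theorem continuous_hfun : Continuous hfun := by
  rw [show hfun = fun s => max 0 (1 - s ^ 2) from funext hfun_eq_max]
  fun_prop

theorem isClosed_exists_mem_compact {X Y : Type*} [TopologicalSpace X] [TopologicalSpace Y]
    {K : Set Y} (hK : IsCompact K) {S : Set (X × Y)} (hS : IsClosed S) :
    IsClosed {x | ∃ y ∈ K, (x, y) ∈ S} := by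
  have := isCompact_iff_compactSpace.1 hK
  have h1 : IsClosed ((fun p : X × K => (p.1, (p.2 : Y))) ⁻¹' S) :=
    hS.preimage (by fun_prop)
  have h2 := isClosedMap_fst_of_compactSpace _ h1
  convert h2 using 1
  ext x
  constructor
  · rintro ⟨y, hy, hxy⟩
    exact ⟨(x, ⟨y, hy⟩), hxy, rfl⟩
  · rintro ⟨⟨x', y⟩, hxy, rfl⟩
    exact ⟨y, y.2, hxy⟩

theorem isLocalizingBox_iff_exists_orthonormal {ξ ζ : ℝ} (e : Exponents ξ ζ) (V : Zd d → ℝ) (L : ℝ)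
    (c : Fin d → ℝ) (m E A : ℝ) :
    IsLocalizingBox e V L c m E A ↔
      (L ^ (-e.κ') ≤ m ∧ m ≤ 1 / 2 * Real.log (1 + A / (4 * d))) ∧
      ∃ φ ∈ Set.univ.pi fun _ : box L c => Metric.sphere (0 : EuclideanSpace ℂ (box L c)) 1,
        (∀ i j, inner ℂ (φ i) (φ j) = if i = j then 1 else 0) ∧
        ∀ j, IsEigenpair V (box L c) (φ j) (rayleigh V (box L c) (φ j)) ∧
          ∃ x ∈ box L c,
            IsLocalizedAt e.τ L c (φ j) x (m * hI E A (rayleigh V (box L c) (φ j))) := by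
  unfold IsLocalizingBox
  rw [← and_assoc]
  refine and_congr_right fun _ => ⟨?_, ?_⟩
  · rintro ⟨φ, θ, h⟩
    refine ⟨φ, fun j _ => ?_, orthonormal_iff_ite.1 φ.orthonormal, fun j => ?_⟩
    · simp
    · rw [(h j).1.rayleigh_eq]
      exact h j
  · rintro ⟨φ, _, hon, h⟩
    have hφ : Orthonormal ℂ φ := orthonormal_iff_ite.2 hon
    have hspan := hφ.linearIndependent.span_eq_top_of_card_eq_finrank' (by simp)
    refine ⟨OrthonormalBasis.mk hφ hspan.ge, fun j => rayleigh V (box L c) (φ j), fun j => ?_⟩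
    rw [OrthonormalBasis.coe_mk]
    exact h j

theorem isClosed_isLocalizingBox {ξ ζ : ℝ} (e : Exponents ξ ζ) (L : ℝ)
    (c : Fin d → ℝ) (m E A : ℝ) : IsClosed {V : Zd d → ℝ | IsLocalizingBox e V L c m E A} := by
  simp only [isLocalizingBox_iff_exists_orthonormal, Set.ofPred_and]
  refine ((isClosed_const (X := Zd d → ℝ)).inter isClosed_const).inter ?_
  refine isClosed_exists_mem_compact
    (S := {p : (Zd d → ℝ) × (box L c → EuclideanSpace ℂ (box L c)) |
      (∀ i j, inner ℂ (p.2 i) (p.2 j) = if i = j then 1 else 0) ∧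
      ∀ j, IsEigenpair p.1 (box L c) (p.2 j) (rayleigh p.1 (box L c) (p.2 j)) ∧
        ∃ x ∈ box L c,
          IsLocalizedAt e.τ L c (p.2 j) x (m * hI E A (rayleigh p.1 (box L c) (p.2 j)))})
    (isCompact_univ_pi fun _ => isCompact_sphere _ _) ?_
  have hj : ∀ j : box L c, Continuous fun p : (Zd d → ℝ) × (box L c → EuclideanSpace ℂ (box L c)) =>
      (p.1, p.2 j) := fun j => by fun_prop
  have hray : ∀ j : box L c, Continuous fun p : (Zd d → ℝ) ×
      (box L c → EuclideanSpace ℂ (box L c)) => rayleigh p.1 (box L c) (p.2 j) :=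
    fun j => (continuous_rayleigh (box L c)).comp (hj j)
  simp only [Set.ofPred_and, Set.ofPred_forall]
  refine (isClosed_iInter fun i => isClosed_iInter fun j => isClosed_eq (by fun_prop)
    continuous_const).inter (isClosed_iInter fun j => ?_)
  refine ((isClosed_isEigenpair (box L c)).preimage (hj j)).inter ?_
  have hun : {p : (Zd d → ℝ) × (box L c → EuclideanSpace ℂ (box L c)) | ∃ x ∈ box L c,
        IsLocalizedAt e.τ L c (p.2 j) x (m * hI E A (rayleigh p.1 (box L c) (p.2 j)))} =
      ⋃ x ∈ box L c, {p | IsLocalizedAt e.τ L c (p.2 j) x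
        (m * hI E A (rayleigh p.1 (box L c) (p.2 j)))} := by
    ext p
    simp
  rw [hun]
  refine isClosed_biUnion_finset fun x _ => ?_
  unfold IsLocalizedAt hI
  simp only [Set.ofPred_and, Set.ofPred_forall]
  refine (isClosed_eq (by fun_prop) continuous_const).inter
    (isClosed_iInter fun y => isClosed_iInter fun _ => isClosed_le (by fun_prop) ?_)
  have h1 := hray j
  have h2 := continuous_hfun
  fun_prop

/-! ### Close eigenvalues -/

/-- `H_Θ` and `H_Θ'` have eigenvalues at distance at most `ε`, and that of `H_Θ` has an
eigenfunction that is not small at `x`. -/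
def HasCloseEigenvalues (Θ Θ' : Finset (Zd d)) (ε : ℝ) (x : Θ) (V : Zd d → ℝ) : Prop :=
  ∃ φ t φ' t', IsEigenpair V Θ φ t ∧ IsEigenpair V Θ' φ' t' ∧ |t - t'| ≤ ε ∧
    1 ≤ Θ.card * ‖φ x‖ ^ 2

theorem isClosed_hasCloseEigenvalues (Θ Θ' : Finset (Zd d)) (ε : ℝ) (x : Θ) :
    IsClosed {V | HasCloseEigenvalues Θ Θ' ε x V} := by
  have heq : {V : Zd d → ℝ | HasCloseEigenvalues Θ Θ' ε x V} =
      {V | ∃ q ∈ Metric.sphere (0 : EuclideanSpace ℂ Θ) 1 ×ˢ Metric.sphere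
          (0 : EuclideanSpace ℂ Θ') 1, (V, q) ∈
        {p : (Zd d → ℝ) × (EuclideanSpace ℂ Θ × EuclideanSpace ℂ Θ') |
          IsEigenpair p.1 Θ p.2.1 (rayleigh p.1 Θ p.2.1) ∧
          IsEigenpair p.1 Θ' p.2.2 (rayleigh p.1 Θ' p.2.2) ∧
          |rayleigh p.1 Θ p.2.1 - rayleigh p.1 Θ' p.2.2| ≤ ε ∧
          1 ≤ Θ.card * ‖p.2.1 x‖ ^ 2}} := by
    ext V
    constructor
    · rintro ⟨φ, t, φ', t', h, h', hε, hx⟩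
      refine ⟨(φ, φ'), ⟨by simpa using h.1, by simpa using h'.1⟩, ?_⟩
      simp only [Set.mem_ofPred_eq, h.rayleigh_eq, h'.rayleigh_eq]
      exact ⟨h, h', hε, hx⟩
    · rintro ⟨q, _, h, h', hε, hx⟩
      exact ⟨_, _, _, _, h, h', hε, hx⟩
  rw [heq]
  refine isClosed_exists_mem_compact ((isCompact_sphere _ _).prod (isCompact_sphere _ _)) ?_
  have h1 : Continuous fun p : (Zd d → ℝ) × (EuclideanSpace ℂ Θ × EuclideanSpace ℂ Θ') =>
      (p.1, p.2.1) := by fun_prop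
  have h2 : Continuous fun p : (Zd d → ℝ) × (EuclideanSpace ℂ Θ × EuclideanSpace ℂ Θ') =>
      (p.1, p.2.2) := by fun_prop
  have h3 := (continuous_rayleigh Θ).comp h1
  have h4 := (continuous_rayleigh Θ').comp h2
  simp only [Set.ofPred_and]
  refine ((isClosed_isEigenpair Θ).preimage h1).inter
    (((isClosed_isEigenpair Θ').preimage h2).inter ((isClosed_le ?_ continuous_const).inter
      (isClosed_le continuous_const (by fun_prop))))
  exact (h3.sub h4).abs

theorem hasCloseEigenvalues_congr {Θ Θ' : Finset (Zd d)} {V V' : Zd d → ℝ}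
    (h : ∀ z ∈ Θ, V z = V' z) (h' : ∀ z ∈ Θ', V z = V' z) (ε : ℝ) (x : Θ) :
    HasCloseEigenvalues Θ Θ' ε x V ↔ HasCloseEigenvalues Θ Θ' ε x V' := by
  unfold HasCloseEigenvalues
  simp only [isEigenpair_congr h, isEigenpair_congr h']

theorem exists_one_le_card_mul_sq {Θ : Finset (Zd d)} {φ : EuclideanSpace ℂ Θ} (h : ‖φ‖ = 1) :
    ∃ x, 1 ≤ Θ.card * ‖φ x‖ ^ 2 := by
  by_contra hc
  push Not at hc
  have h1 : ∑ x, ‖φ x‖ ^ 2 = 1 := by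
    rw [← EuclideanSpace.norm_sq_eq, h, one_pow]
  have hne : (Finset.univ : Finset Θ).Nonempty := by
    by_contra he
    rw [Finset.not_nonempty_iff_eq_empty] at he
    rw [he] at h1
    simp at h1
  have hpos : (0 : ℝ) < Θ.card := by
    obtain ⟨x, _⟩ := hne
    exact_mod_cast Finset.card_pos.2 ⟨(x : Zd d), x.2⟩
  have h2 := Finset.sum_lt_sum_of_nonempty hne fun x _ => hc x
  rw [← Finset.mul_sum, h1, Finset.sum_const, Finset.card_univ, Fintype.card_coe] at h2
  simp at h2

/-- Changing the potential at one site moves eigenvalues whose eigenfunctions see that site. -/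
theorem abs_sub_mul_le_of_isEigenpair {V V' : Zd d → ℝ} {Θ : Finset (Zd d)} {x : Θ}
    (hV : ∀ z, z ≠ (x : Zd d) → V z = V' z) {φ φ' : EuclideanSpace ℂ Θ} {t t' : ℝ}
    (h : IsEigenpair V Θ φ t) (h' : IsEigenpair V' Θ φ' t') :
    |V x - V' x| * (‖φ x‖ * ‖φ' x‖) ≤ |t - t'| := by
  have h1 : ∀ z, ∑ y, hamMatrix V' 0 Θ z y * φ y =
      t * φ z - if z = x then ((V x - V' x : ℝ) : ℂ) * φ x else 0 := by
    intro z
    rw [sum_hamMatrix_mul, ← h.2 z]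
    unfold schrodinger
    rw [extendZero_coe]
    split_ifs with hz
    · subst hz
      push_cast
      ring
    · rw [hV z fun hc => hz (Subtype.ext hc)]
      simp
  have h2 := sum_star_mul_hermitian (hamMatrix_isHermitian V' 0 Θ) (φ := φ') (t := t')
    (fun z => by simpa using h'.hamMatrix_mul 0 z) φ
  simp only [h1, mul_sub, Finset.sum_sub_distrib] at h2
  have h3 : ∑ z, star (φ' z) * (t * φ z) = t * ∑ z, star (φ' z) * φ z := by
    rw [Finset.mul_sum]
    exact Finset.sum_congr rfl fun z _ => by ring
  have h4 : ∑ z, star (φ' z) * (if z = x then ((V x - V' x : ℝ) : ℂ) * φ x else 0) =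
      star (φ' x) * (((V x - V' x : ℝ) : ℂ) * φ x) := by
    simp
  rw [h3, h4] at h2
  have h5 : star (φ' x) * (((V x - V' x : ℝ) : ℂ) * φ x) =
      ((t - t' : ℝ) : ℂ) * ∑ z, star (φ' z) * φ z := by
    push_cast at h2 ⊢
    linear_combination -h2
  have h6 : ‖∑ z, star (φ' z) * φ z‖ ≤ 1 := by
    have h7 : ∑ z, star (φ' z) * φ z = inner ℂ φ' φ := by
      rw [PiLp.inner_apply]
      exact Finset.sum_congr rfl fun z _ => by simp [mul_comm]
    rw [h7]
    refine (norm_inner_le_norm _ _).trans ?_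
    rw [h.1, h'.1, one_mul]
  have h8 := congrArg norm h5
  rw [norm_mul, norm_mul, norm_mul, norm_star, Complex.norm_real, Complex.norm_real,
    Real.norm_eq_abs, Real.norm_eq_abs] at h8
  calc |V x - V' x| * (‖φ x‖ * ‖φ' x‖) = ‖φ' x‖ * (|V x - V' x| * ‖φ x‖) := by ring
    _ = _ := h8
    _ ≤ _ := mul_le_of_le_one_right (abs_nonneg _) h6

theorem exists_eigenvalues (V : Zd d → ℝ) (Θ : Finset (Zd d)) :
    ∃ s : Θ → ℝ, ∀ φ t, IsEigenpair V Θ φ t → ∃ k, s k = t := by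
  classical
  have hH := hamMatrix_isHermitian V 0 Θ
  refine ⟨hH.eigenvalues, fun φ t h => ?_⟩
  by_contra hc
  push Not at hc
  have h1 : ∀ j x, ∑ y, hamMatrix V 0 Θ x y * hH.eigenvectorBasis j y =
      hH.eigenvalues j * hH.eigenvectorBasis j x := by
    intro j x
    have := congrFun (hH.mulVec_eigenvectorBasis j) x
    simpa [Matrix.mulVec, dotProduct] using this
  have h2 := restrict_eq_sum_resolvent hH.eigenvectorBasis _ hH h1 hc (ψ := φ) (g := 0)
    (fun x => by simpa using h.hamMatrix_mul 0 x)
  have h3 : φ = 0 := by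
    ext y
    simpa using h2 y
  have h4 := h.1
  rw [h3, norm_zero] at h4
  exact zero_ne_one h4

end Measurability

section Wegner

variable {d : ℕ}

theorem measure_le_of_diam_le {μ : Measure ℝ} [IsProbabilityMeasure μ] {K α δ : ℝ}
    (hK : ∀ t ∈ Set.Icc (0 : ℝ) 1, (⨆ a : ℝ, μ.real (Set.Icc a (a + t))) ≤ K * t ^ α)
    (hδ : δ ∈ Set.Icc (0 : ℝ) 1) {S : Set ℝ} (hS : ∀ v ∈ S, ∀ v' ∈ S, |v - v'| ≤ δ) :
    μ S ≤ ENNReal.ofReal (K * δ ^ α) := by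
  rcases S.eq_empty_or_nonempty with rfl | ⟨v₀, hv₀⟩
  · simp
  have hbdd : BddBelow S := ⟨v₀ - δ, fun v hv => by linarith [(abs_le.1 (hS v hv v₀ hv₀)).1]⟩
  have hsub : S ⊆ Set.Icc (sInf S) (sInf S + δ) := by
    intro v hv
    refine ⟨csInf_le hbdd hv, ?_⟩
    have : v - δ ≤ sInf S :=
      le_csInf ⟨v₀, hv₀⟩ fun v' hv' => by linarith [(abs_le.1 (hS v hv v' hv')).2]
    linarith
  refine (measure_mono hsub).trans ?_
  rw [← ofReal_measureReal]
  refine ENNReal.ofReal_le_ofReal (le_trans ?_ (hK δ hδ))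
  exact le_ciSup (f := fun a : ℝ => μ.real (Set.Icc a (a + δ)))
    ⟨1, by rintro _ ⟨a, rfl⟩; exact measureReal_le_one⟩ (sInf S)

/-- Wegner estimate at a fixed energy in one random variable. -/
theorem measure_eigenvalue_near_update_le {μ : Measure ℝ} [IsProbabilityMeasure μ] {K α ε : ℝ}
    (hK : ∀ t ∈ Set.Icc (0 : ℝ) 1, (⨆ a : ℝ, μ.real (Set.Icc a (a + t))) ≤ K * t ^ α)
    {Θ : Finset (Zd d)} (hε : 0 ≤ ε) (hε1 : 2 * ε * Θ.card ≤ 1) (x : Θ) (V : Zd d → ℝ) (E : ℝ) :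
    μ {v | ∃ φ t, IsEigenpair (Function.update V x v) Θ φ t ∧ |t - E| ≤ ε ∧
      1 ≤ Θ.card * ‖φ x‖ ^ 2} ≤ ENNReal.ofReal (K * (2 * ε * Θ.card) ^ α) := by
  have h0 : 0 ≤ 2 * ε * Θ.card := mul_nonneg (by linarith) (Nat.cast_nonneg _)
  refine measure_le_of_diam_le hK ⟨h0, hε1⟩ ?_
  rintro v ⟨φ, t, h, ht, hx1⟩ v' ⟨φ', t', h', ht', hx1'⟩
  have h1 := abs_sub_mul_le_of_isEigenpair (x := x) (fun z hz => by
    rw [Function.update_of_ne hz, Function.update_of_ne hz]) h h'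
  simp only [Function.update_self] at h1
  have h2 : |t - t'| ≤ 2 * ε := by
    have := abs_sub_le t E t'
    rw [abs_sub_comm E t'] at this
    linarith
  have hc : (0 : ℝ) ≤ Θ.card := Nat.cast_nonneg _
  have h3 : 1 ≤ Θ.card * (‖φ x‖ * ‖φ' x‖) := by
    have h4 : 1 ≤ (Θ.card * (‖φ x‖ * ‖φ' x‖)) ^ 2 := by
      calc (1 : ℝ) = 1 * 1 := by ring
        _ ≤ (Θ.card * ‖φ x‖ ^ 2) * (Θ.card * ‖φ' x‖ ^ 2) := by gcongr
        _ = _ := by ring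
    exact (one_le_sq_iff₀ (by positivity)).1 h4
  calc |v - v'| ≤ |v - v'| * (Θ.card * (‖φ x‖ * ‖φ' x‖)) :=
        le_mul_of_one_le_right (abs_nonneg _) h3
    _ = Θ.card * (|v - v'| * (‖φ x‖ * ‖φ' x‖)) := by ring
    _ ≤ Θ.card * (2 * ε) := by
        refine mul_le_mul_of_nonneg_left (h1.trans h2) hc
    _ = 2 * ε * Θ.card := by ring

/-- Wegner estimate in one random variable. -/
theorem measure_hasCloseEigenvalues_update_le {μ : Measure ℝ} [IsProbabilityMeasure μ] {K α ε : ℝ}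
    (hK : ∀ t ∈ Set.Icc (0 : ℝ) 1, (⨆ a : ℝ, μ.real (Set.Icc a (a + t))) ≤ K * t ^ α)
    {Θ Θ' : Finset (Zd d)} (hε : 0 ≤ ε) (hε1 : 2 * ε * Θ.card ≤ 1) (x : Θ) (hx : (x : Zd d) ∉ Θ')
    (V : Zd d → ℝ) :
    μ {v | HasCloseEigenvalues Θ Θ' ε x (Function.update V x v)} ≤
      Θ'.card * ENNReal.ofReal (K * (2 * ε * Θ.card) ^ α) := by
  obtain ⟨s, hs⟩ := exists_eigenvalues V Θ'
  set S : Θ' → Set ℝ := fun k => {v | ∃ φ t, IsEigenpair (Function.update V x v) Θ φ t ∧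
    |t - s k| ≤ ε ∧ 1 ≤ Θ.card * ‖φ x‖ ^ 2} with hS
  have hsub : {v | HasCloseEigenvalues Θ Θ' ε x (Function.update V x v)} ⊆ ⋃ k, S k := by
    rintro v ⟨φ, t, φ', t', h, h', hε, hx1⟩
    have h2 : IsEigenpair V Θ' φ' t' := by
      refine (isEigenpair_congr (fun z hz => ?_) φ' t').1 h'
      rw [Function.update_of_ne]
      rintro rfl
      exact hx hz
    obtain ⟨k, hk⟩ := hs φ' t' h2
    exact Set.mem_iUnion.2 ⟨k, φ, t, h, by rwa [hk], hx1⟩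
  have hk : ∀ k, μ (S k) ≤ ENNReal.ofReal (K * (2 * ε * Θ.card) ^ α) := by
    intro k
    exact measure_eigenvalue_near_update_le hK hε hε1 x V (s k)
  refine (measure_mono hsub).trans ((measure_iUnion_fintype_le _ _).trans ?_)
  refine (Finset.sum_le_sum fun k _ => hk k).trans (le_of_eq ?_)
  simp

theorem measure_hasCloseEigenvalues_le {Ω : Type*} [MeasurableSpace Ω] {P : Measure Ω}
    [IsProbabilityMeasure P] {μ : Measure ℝ} [IsProbabilityMeasure μ] {ω : Zd d → Ω → ℝ}
    (hω : IsAndersonPotential P μ ω) {K α ε : ℝ}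
    (hK : ∀ t ∈ Set.Icc (0 : ℝ) 1, (⨆ a : ℝ, μ.real (Set.Icc a (a + t))) ≤ K * t ^ α)
    {Θ Θ' : Finset (Zd d)} (hε : 0 ≤ ε) (hε1 : 2 * ε * Θ.card ≤ 1) (x : Θ)
    (hx : (x : Zd d) ∉ Θ') :
    P {s | HasCloseEigenvalues Θ Θ' ε x fun z => ω z s} ≤
      Θ'.card * ENNReal.ofReal (K * (2 * ε * Θ.card) ^ α) := by
  obtain ⟨hmeas, hind, hlaw⟩ := hω
  set J := (Θ ∪ Θ').erase (x : Zd d) with hJ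
  set X : Ω → J → ℝ := fun s z => ω z s with hX
  have hXm : Measurable X := measurable_pi_lambda _ fun z => hmeas z
  have hindep : IndepFun X (ω x) P := by
    have h1 := hind.indepFun_finset J {(x : Zd d)} (by simp [hJ]) hmeas
    exact h1.comp (φ := id) (ψ := fun g : (({(x : Zd d)} : Finset (Zd d)) → ℝ) =>
      g ⟨x, Finset.mem_singleton_self _⟩) measurable_id (measurable_pi_apply _)
  set ext : (J → ℝ) → Zd d → ℝ := fun g z => if h : z ∈ J then g ⟨z, h⟩ else 0 with hext
  set T : (J → ℝ) × ℝ → Zd d → ℝ := fun p => Function.update (ext p.1) x p.2 with hT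
  have hTm : Measurable T := by
    refine measurable_pi_lambda _ fun z => ?_
    by_cases hz : z = x
    · simp only [hT, hz, Function.update_self]
      exact measurable_snd
    · simp only [hT, Function.update_of_ne hz, hext]
      split_ifs
      · fun_prop
      · fun_prop
  set C : Set ((J → ℝ) × ℝ) := T ⁻¹' {V | HasCloseEigenvalues Θ Θ' ε x V} with hC
  have hCm : MeasurableSet C := hTm (isClosed_hasCloseEigenvalues Θ Θ' ε x).measurableSet
  have hev : {s | HasCloseEigenvalues Θ Θ' ε x fun z => ω z s} = (fun s => (X s, ω x s)) ⁻¹' C := by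
    ext s
    have hagree : ∀ z ∈ Θ ∪ Θ', ω z s = T (X s, ω x s) z := by
      intro z hz
      by_cases hzx : z = x
      · simp [hT, hzx]
      · have hzJ : z ∈ J := Finset.mem_erase.2 ⟨hzx, hz⟩
        simp only [hT, Function.update_of_ne hzx, hext, dif_pos hzJ, hX]
    exact hasCloseEigenvalues_congr (fun z hz => hagree z (Finset.mem_union_left _ hz))
      (fun z hz => hagree z (Finset.mem_union_right _ hz)) ε x
  rw [hev, ← Measure.map_apply (hXm.prodMk (hmeas x)) hCm,
    (indepFun_iff_map_prod_eq_prod_map_map hXm.aemeasurable (hmeas x).aemeasurable).1 hindep,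
    hlaw, Measure.prod_apply hCm]
  have : IsProbabilityMeasure (P.map X) := Measure.isProbabilityMeasure_map hXm.aemeasurable
  refine (lintegral_mono fun g => measure_hasCloseEigenvalues_update_le hK hε hε1 x hx
    (ext g)).trans ?_
  simp

theorem exists_poly_mul_exp_le (d : ℕ) {α ξ β : ℝ} (hα : 0 < α) (hξ : 0 < ξ) (hβ : ξ < β) :
    ∃ C : ℝ, 0 ≤ C ∧ ∀ L : ℝ, 1 ≤ L →
      (L + 1) ^ (3 * d) * Real.exp (-(α * L ^ β)) ≤ C * Real.exp (-L ^ ξ) := by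
  have h1 := eventually_mul_rpow_le_exp_rpow (2 ^ (3 * d)) ((3 * d : ℕ) : ℝ) hξ
  have h2 := (tendsto_rpow_atTop (sub_pos.2 hβ)).eventually_ge_atTop (2 / α)
  obtain ⟨L₁, hL₁⟩ := Filter.eventually_atTop.1 (h1.and h2)
  set M := max L₁ 1 with hM
  have hM1 : 1 ≤ M := le_max_right _ _
  refine ⟨max 1 ((M + 1) ^ (3 * d) * Real.exp (M ^ ξ)), by positivity, fun L hL => ?_⟩
  have hL0 : 0 < L := by linarith
  by_cases hLM : L₁ ≤ L
  · obtain ⟨h3, h4⟩ := hL₁ L hLM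
    have h5 : (L + 1) ^ (3 * d) ≤ Real.exp (L ^ ξ) := by
      refine le_trans ?_ h3
      rw [Real.rpow_natCast, ← mul_pow]
      gcongr
      linarith
    have h6 : 2 * L ^ ξ ≤ α * L ^ β := by
      rw [div_le_iff₀ hα] at h4
      calc 2 * L ^ ξ ≤ L ^ (β - ξ) * α * L ^ ξ := by gcongr
        _ = α * (L ^ (β - ξ) * L ^ ξ) := by ring
        _ = α * L ^ β := by
          rw [← Real.rpow_add hL0]
          simp
    calc (L + 1) ^ (3 * d) * Real.exp (-(α * L ^ β))
        ≤ Real.exp (L ^ ξ) * Real.exp (-(α * L ^ β)) := by gcongr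
      _ ≤ 1 * Real.exp (-L ^ ξ) := by
          rw [← Real.exp_add, one_mul, Real.exp_le_exp]
          linarith
      _ ≤ _ := by
          gcongr
          exact le_max_left _ _
  · have hLM' : L ≤ M := (not_le.1 hLM).le.trans (le_max_left _ _)
    have h7 : L ^ ξ ≤ M ^ ξ := Real.rpow_le_rpow hL0.le hLM' hξ.le
    calc (L + 1) ^ (3 * d) * Real.exp (-(α * L ^ β)) ≤ (M + 1) ^ (3 * d) * 1 := by
          gcongr
          rw [Real.exp_le_one_iff]
          have : 0 ≤ α * L ^ β := by positivity
          linarith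
      _ ≤ (M + 1) ^ (3 * d) * (Real.exp (M ^ ξ) * Real.exp (-L ^ ξ)) := by
          gcongr
          rw [← Real.exp_add]
          exact Real.one_le_exp (by linarith)
      _ ≤ _ := by
          rw [← mul_assoc]
          gcongr
          exact le_max_right _ _

/-- Two disjoint boxes have close eigenvalues only with small probability. -/
theorem exists_wegner_const (d : ℕ) {ξ ζ : ℝ} (e : Exponents ξ ζ) {μ : Measure ℝ}
    (hμ : IsSingleSiteLaw μ) :
    ∃ C : ℝ, 0 ≤ C ∧ ∀ (Ω : Type*) [MeasurableSpace Ω] (P : Measure Ω) [IsProbabilityMeasure P]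
      (ω : Zd d → Ω → ℝ), IsAndersonPotential P μ ω → ∀ L : ℝ, 1 ≤ L →
      2 * Real.exp (-L ^ e.β) * (L + 1) ^ d ≤ 1 → ∀ c c' : Fin d → ℝ,
      Disjoint (box L c) (box L c') →
      P.real {s | ∃ x, HasCloseEigenvalues (box L c) (box L c') (Real.exp (-L ^ e.β)) x
        fun z => ω z s} ≤ C * Real.exp (-L ^ ξ) := by
  obtain ⟨hprob, -, α, K, hα, hα1, hK⟩ := hμ
  have hβ : ξ < e.β := e.ξ_lt_ζ.trans e.ζ_lt_β
  obtain ⟨C₀, hC₀, hbound⟩ := exists_poly_mul_exp_le d hα e.ξ_pos hβ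
  refine ⟨2 * max K 0 * C₀, by positivity, ?_⟩
  intro Ω _ P _ ω hω L hL hLs c c' hdisj
  set ε := Real.exp (-L ^ e.β) with hε
  have hε0 : 0 < ε := Real.exp_pos _
  have hL0 : 0 ≤ L := by linarith
  have hn := card_box_le hL0 c
  have hn' := card_box_le hL0 c'
  set n : ℝ := ((box L c).card : ℝ) with hn_def
  set n' : ℝ := ((box L c').card : ℝ) with hn'_def
  have hn0 : 0 ≤ n := Nat.cast_nonneg _
  have hn0' : 0 ≤ n' := Nat.cast_nonneg _
  set D := (L + 1) ^ d with hD
  have hD1 : 1 ≤ D := one_le_pow₀ (by linarith)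
  have hεn : 2 * ε * n ≤ 1 := le_trans (by gcongr) hLs
  have hterm : ∀ x : box L c, P.real {s | HasCloseEigenvalues (box L c) (box L c') ε x
      fun z => ω z s} ≤ n' * (max K 0 * (2 * ε * n) ^ α) := by
    intro x
    have hx : (x : Zd d) ∉ box L c' := fun h => Finset.disjoint_left.1 hdisj x.2 h
    have h1 := measure_hasCloseEigenvalues_le hω hK hε0.le hεn x hx
    refine ENNReal.toReal_le_of_le_ofReal (by positivity) (h1.trans ?_)
    rw [ENNReal.ofReal_mul hn0', hn'_def, ENNReal.ofReal_natCast]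
    gcongr
    exact le_max_left _ _
  have hset : {s | ∃ x, HasCloseEigenvalues (box L c) (box L c') ε x fun z => ω z s} =
      ⋃ x, {s | HasCloseEigenvalues (box L c) (box L c') ε x fun z => ω z s} := by
    ext s
    simp
  rw [hset]
  refine (measureReal_iUnion_fintype_le _).trans ((Finset.sum_le_sum fun x _ => hterm x).trans ?_)
  rw [Finset.sum_const, Finset.card_univ, Fintype.card_coe, nsmul_eq_mul, ← hn_def]
  have hpow : (2 * ε * n) ^ α ≤ 2 * D * Real.exp (-(α * L ^ e.β)) := by
    calc (2 * ε * n) ^ α ≤ (2 * ε * D) ^ α := by gcongr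
      _ = (2 * D) ^ α * ε ^ α := by
          rw [← Real.mul_rpow (by positivity) hε0.le]
          congr 1
          ring
      _ ≤ 2 * D * Real.exp (-(α * L ^ e.β)) := by
          refine mul_le_mul ?_ (le_of_eq ?_) (by positivity) (by positivity)
          · exact Real.rpow_le_self_of_one_le (by linarith) hα1
          · rw [hε, ← Real.exp_mul]
            congr 1
            ring
  calc n * (n' * (max K 0 * (2 * ε * n) ^ α))
      ≤ D * (D * (max K 0 * (2 * D * Real.exp (-(α * L ^ e.β))))) := by gcongr
    _ = 2 * max K 0 * ((L + 1) ^ (3 * d) * Real.exp (-(α * L ^ e.β))) := by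
        rw [hD, mul_comm 3 d, pow_mul]
        ring
    _ ≤ 2 * max K 0 * (C₀ * Real.exp (-L ^ ξ)) := by
        exact mul_le_mul_of_nonneg_left (hbound L hL) (by positivity)
    _ = _ := by ring

end Wegner

section Cover

variable {d : ℕ}

/-! ### A cover of the annulus -/

/-- Indices of the boxes that cover the annulus: `k ∈ {-4, …, 4}^d` with `‖k‖ ≥ 3`. -/
noncomputable def coverIndices (d : ℕ) : Finset (Zd d) :=
  (Fintype.piFinset fun _ => Finset.Icc (-4 : ℤ) 4).filter fun k => ∃ i, 3 ≤ |k i|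

/-- The center `a + (L / 2) k` of a box of the cover. -/
noncomputable def coverCenter (L : ℝ) (a k : Zd d) : Fin d → ℝ := fun i => a i + L / 2 * k i

theorem mem_coverIndices {k : Zd d} :
    k ∈ coverIndices d ↔ (∀ i, -4 ≤ k i ∧ k i ≤ 4) ∧ ∃ i, 3 ≤ |k i| := by
  simp [coverIndices]

theorem card_coverIndices_le (d : ℕ) : ((coverIndices d).card : ℝ) ≤ 9 ^ d := by
  have h := Finset.card_filter_le (Fintype.piFinset fun _ : Fin d => Finset.Icc (-4 : ℤ) 4)
    fun k => ∃ i, 3 ≤ |k i|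
  rw [Fintype.card_piFinset] at h
  simp only [Int.card_Icc, Finset.prod_const, Finset.card_univ, Fintype.card_fin] at h
  exact_mod_cast h

theorem norm_coverCenter_sub_le {L : ℝ} (hL : 0 ≤ L) (a : Zd d) {k : Zd d}
    (hk : k ∈ coverIndices d) : ‖coverCenter L a k - toR a‖ ≤ 2 * L := by
  refine (pi_norm_le_iff_of_nonneg (by positivity)).2 fun i => ?_
  obtain ⟨h1, h2⟩ := (mem_coverIndices.1 hk).1 i
  have h1' : (-4 : ℝ) ≤ k i := by exact_mod_cast h1
  have h2' : (k i : ℝ) ≤ 4 := by exact_mod_cast h2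
  simp only [coverCenter, toR, Pi.sub_apply, add_sub_cancel_left, Real.norm_eq_abs]
  rw [abs_le]
  constructor <;> nlinarith

theorem disjoint_box_coverCenter {L : ℝ} (hL : 0 < L) (a : Zd d) {k : Zd d}
    (hk : k ∈ coverIndices d) : Disjoint (box L (toR a)) (box L (coverCenter L a k)) := by
  refine Finset.disjoint_left.2 fun z hz hz' => ?_
  obtain ⟨i, hi⟩ := (mem_coverIndices.1 hk).2
  have h1 : |(z i : ℝ) - a i| ≤ L / 2 := (norm_le_pi_norm (toR z - toR a) i).trans (mem_box.1 hz)
  have h2 : |(z i : ℝ) - (a i + L / 2 * k i)| ≤ L / 2 :=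
    (norm_le_pi_norm (toR z - coverCenter L a k) i).trans (mem_box.1 hz')
  rw [abs_le] at h1 h2
  rcases le_abs.1 hi with h3 | h3
  · have h4 : (3 : ℝ) ≤ k i := by exact_mod_cast h3
    nlinarith
  · have h4 : (3 : ℝ) ≤ -k i := by exact_mod_cast h3
    nlinarith

theorem box_subset_box {L M : ℝ} {c : Fin d → ℝ} {b : Fin d → ℝ} (h : ‖c - b‖ + L / 2 ≤ M / 2) :
    box L c ⊆ box M b := by
  intro z hz
  refine mem_box.2 ?_
  have h1 : ‖toR z - b‖ ≤ ‖toR z - c‖ + ‖c - b‖ := by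
    simpa using norm_add_le (toR z - c) (c - b)
  linarith [mem_box.1 hz]

theorem exists_cover_coord_of_nonneg {L t : ℝ} (hL : 0 < L) (ht : 0 ≤ t) (ht' : t ≤ 33 / 14 * L) :
    ∃ k : ℤ, -4 ≤ k ∧ k ≤ 4 ∧ |t - L / 2 * k| ≤ 5 / 14 * L ∧ (8 / 7 * L ≤ t → 3 ≤ |k|) := by
  by_cases h4 : 12 / 7 * L ≤ t
  · refine ⟨4, by norm_num, by norm_num, ?_, by norm_num⟩
    rw [abs_le]
    constructor <;> push_cast <;> linarith
  by_cases h3 : 8 / 7 * L ≤ t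
  · refine ⟨3, by norm_num, by norm_num, ?_, by norm_num⟩
    rw [abs_le]
    constructor <;> push_cast <;> linarith
  by_cases h2 : 5 / 7 * L ≤ t
  · refine ⟨2, by norm_num, by norm_num, ?_, fun h => absurd h h3⟩
    rw [abs_le]
    constructor <;> push_cast <;> linarith
  by_cases h1 : 2 / 7 * L ≤ t
  · refine ⟨1, by norm_num, by norm_num, ?_, fun h => absurd h h3⟩
    rw [abs_le]
    constructor <;> push_cast <;> linarith
  · refine ⟨0, by norm_num, by norm_num, ?_, fun h => absurd h h3⟩
    rw [abs_le]
    constructor <;> push_cast <;> linarith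

theorem exists_cover_coord {L t : ℝ} (hL : 0 < L) (ht : |t| ≤ 33 / 14 * L) :
    ∃ k : ℤ, -4 ≤ k ∧ k ≤ 4 ∧ |t - L / 2 * k| ≤ 5 / 14 * L ∧ (8 / 7 * L ≤ |t| → 3 ≤ |k|) := by
  obtain ⟨k, h1, h2, h3, h4⟩ := exists_cover_coord_of_nonneg hL (abs_nonneg t) ht
  rcases le_total 0 t with h | h
  · rw [abs_of_nonneg h] at h3 h4 ⊢
    exact ⟨k, h1, h2, h3, h4⟩
  · refine ⟨-k, by linarith, by linarith, ?_, by rwa [abs_neg]⟩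
    rw [abs_of_nonpos h] at h3
    rw [← abs_neg]
    convert h3 using 2
    push_cast
    ring

theorem exists_coverIndex_of_mem_annulus {L : ℝ} (hL : 0 < L) {a y : Zd d} (hy : y ∈ annulus L a) :
    ∃ k ∈ coverIndices d, ‖toR y - coverCenter L a k‖ ≤ 5 / 14 * L := by
  obtain ⟨h1, h2⟩ := hy
  rw [← norm_toR_sub] at h1 h2
  have hcoord : ∀ i, |(y i : ℝ) - a i| ≤ 33 / 14 * L := fun i =>
    (norm_le_pi_norm (toR y - toR a) i).trans h2
  choose k hk1 hk2 hk3 hk4 using fun i => exists_cover_coord hL (hcoord i)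
  obtain ⟨i, hi⟩ : ∃ i, 8 / 7 * L ≤ |(y i : ℝ) - a i| := by
    by_contra hc
    push Not at hc
    exact absurd ((pi_norm_lt_iff (x := toR y - toR a) (r := 8 / 7 * L) (by positivity)).2 hc)
      (not_lt.2 h1)
  refine ⟨k, mem_coverIndices.2 ⟨fun i => ⟨hk1 i, hk2 i⟩, i, hk4 i hi⟩, ?_⟩
  refine (pi_norm_le_iff_of_nonneg (by positivity)).2 fun i => ?_
  have := hk3 i
  rwa [sub_sub] at this

/-! ### The good event -/

/-- Potentials for which the boxes around `a` are localizing and have no resonances with the box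
at `a`. -/
def goodPotentials {ξ ζ : ℝ} (e : Exponents ξ ζ) (L : ℝ) (a : Zd d) (m E A : ℝ) :
    Set (Zd d → ℝ) :=
  {V | IsLocalizingBox e V L (toR a) m E A ∧ ∀ k ∈ coverIndices d,
    IsLocalizingBox e V L (coverCenter L a k) m E A ∧
    ¬∃ x, HasCloseEigenvalues (box L (toR a)) (box L (coverCenter L a k)) (Real.exp (-L ^ e.β)) x V}

theorem measurableSet_goodPotentials {ξ ζ : ℝ} (e : Exponents ξ ζ) (L : ℝ) (a : Zd d)
    (m E A : ℝ) : MeasurableSet (goodPotentials e L a m E A) := by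
  have h1 : ∀ c : Fin d → ℝ, MeasurableSet {V : Zd d → ℝ | IsLocalizingBox e V L c m E A} :=
    fun c => (isClosed_isLocalizingBox e L c m E A).measurableSet
  have h2 : ∀ k : Zd d, MeasurableSet {V : Zd d → ℝ | ∃ x, HasCloseEigenvalues (box L (toR a))
      (box L (coverCenter L a k)) (Real.exp (-L ^ e.β)) x V} := by
    intro k
    rw [Set.ofPred_exists]
    exact MeasurableSet.iUnion fun x => (isClosed_hasCloseEigenvalues _ _ _ x).measurableSet
  unfold goodPotentials
  simp only [Set.ofPred_and, Set.ofPred_forall]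
  refine (h1 _).inter (MeasurableSet.iInter fun k => MeasurableSet.iInter fun _ => ?_)
  exact (h1 _).inter (h2 k).compl

theorem goodPotentials_congr {ξ ζ : ℝ} (e : Exponents ξ ζ) {L : ℝ} (hL : 0 < L) (a : Zd d)
    (m E A : ℝ) {V V' : Zd d → ℝ} (h : ∀ z ∈ box (5 * L) (toR a), V z = V' z) :
    V ∈ goodPotentials e L a m E A ↔ V' ∈ goodPotentials e L a m E A := by
  have h0 : ∀ z ∈ box L (toR a), V z = V' z := fun z hz =>
    h z (box_subset_box (by rw [sub_self, norm_zero]; linarith) hz)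
  have hk : ∀ k ∈ coverIndices d, ∀ z ∈ box L (coverCenter L a k), V z = V' z :=
    fun k hk z hz => h z (box_subset_box (by linarith [norm_coverCenter_sub_le hL.le a hk]) hz)
  refine and_congr (isLocalizingBox_congr e h0 m E A) (forall₂_congr fun k hk' => ?_)
  refine and_congr (isLocalizingBox_congr e (hk k hk') m E A) (not_congr (exists_congr fun x => ?_))
  exact hasCloseEigenvalues_congr h0 (hk k hk') _ x

theorem measurable_truncation {Ω : Type*} (ω : Zd d → Ω → ℝ) (Θ : Finset (Zd d)) :
    Measurable[⨆ x ∈ Θ, MeasurableSpace.comap (ω x) inferInstance]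
      fun s z => if z ∈ Θ then ω z s else 0 := by
  let _ : MeasurableSpace Ω := ⨆ x ∈ Θ, MeasurableSpace.comap (ω x) inferInstance
  refine measurable_pi_lambda _ fun z => ?_
  split_ifs with hz
  · exact (comap_measurable (ω z)).mono
      (le_iSup₂ (f := fun x (_ : x ∈ Θ) => MeasurableSpace.comap (ω x) inferInstance) z hz) le_rfl
  · exact measurable_const

theorem dependsOnlyOn_goodPotentials {Ω : Type*} (ω : Zd d → Ω → ℝ) {ξ ζ : ℝ} (e : Exponents ξ ζ)
    {L : ℝ} (hL : 0 < L) (a : Zd d) (m E A : ℝ) :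
    DependsOnlyOn ω (box (5 * L) (toR a)) {s | (fun z => ω z s) ∈ goodPotentials e L a m E A} := by
  have h := measurable_truncation ω (box (5 * L) (toR a))
    (measurableSet_goodPotentials e L a m E A)
  have heq : {s | (fun z => ω z s) ∈ goodPotentials e L a m E A} =
      (fun s z => if z ∈ box (5 * L) (toR a) then ω z s else 0) ⁻¹'
        goodPotentials e L a m E A := by
    ext s
    exact goodPotentials_congr e hL a m E A fun z hz => (if_pos hz).symm
  unfold DependsOnlyOn
  rw [heq]
  exact h

theorem le_measureReal_goodPotentials {Ω : Type*} [MeasurableSpace Ω] (P : Measure Ω)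
    [IsProbabilityMeasure P] {ω : Zd d → Ω → ℝ} (hω : ∀ x, Measurable (ω x)) {ξ ζ : ℝ}
    (e : Exponents ξ ζ) (L : ℝ) (a : Zd d) {m E A p q : ℝ} (hp : 0 ≤ p) (hq : 0 ≤ q)
    (hloc : ∀ c, 1 - p ≤ P.real {s | IsLocalizingBox e (fun x => ω x s) L c m E A})
    (hres : ∀ k ∈ coverIndices d, P.real {s | ∃ x, HasCloseEigenvalues (box L (toR a))
      (box L (coverCenter L a k)) (Real.exp (-L ^ e.β)) x fun z => ω z s} ≤ q) :
    1 - (p + 9 ^ d * (p + q)) ≤ P.real {s | (fun z => ω z s) ∈ goodPotentials e L a m E A} := by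
  have hm : Measurable fun s z => ω z s := measurable_pi_lambda _ hω
  have hlocm : ∀ c, MeasurableSet {s | IsLocalizingBox e (fun x => ω x s) L c m E A} :=
    fun c => hm (isClosed_isLocalizingBox e L c m E A).measurableSet
  have hloc' : ∀ c, P.real {s | IsLocalizingBox e (fun x => ω x s) L c m E A}ᶜ ≤ p := by
    intro c
    rw [probReal_compl_eq_one_sub (hlocm c)]
    linarith [hloc c]
  have hgm : MeasurableSet {s | (fun z => ω z s) ∈ goodPotentials e L a m E A} :=
    hm (measurableSet_goodPotentials e L a m E A)
  have hsub : {s | (fun z => ω z s) ∈ goodPotentials e L a m E A}ᶜ ⊆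
      {s | IsLocalizingBox e (fun x => ω x s) L (toR a) m E A}ᶜ ∪
      ⋃ k ∈ coverIndices d, ({s | IsLocalizingBox e (fun x => ω x s) L (coverCenter L a k) m E A}ᶜ ∪
        {s | ∃ x, HasCloseEigenvalues (box L (toR a)) (box L (coverCenter L a k))
          (Real.exp (-L ^ e.β)) x fun z => ω z s}) := by
    intro s hs
    by_contra hc
    refine hs ?_
    simp only [Set.mem_union, Set.mem_iUnion, not_or, not_exists] at hc
    refine ⟨not_not.1 hc.1, fun k hk => ⟨not_not.1 (hc.2 k hk).1, ?_⟩⟩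
    rintro ⟨x, hx⟩
    exact (hc.2 k hk).2 ⟨x, hx⟩
  have hcompl : P.real {s | (fun z => ω z s) ∈ goodPotentials e L a m E A}ᶜ ≤
      p + 9 ^ d * (p + q) := by
    refine (measureReal_mono hsub).trans ((measureReal_union_le _ _).trans
      (add_le_add (hloc' _) ((measureReal_biUnion_finset_le _ _).trans ?_)))
    calc _ ≤ ∑ _k ∈ coverIndices d, (p + q) := Finset.sum_le_sum fun k hk =>
          (measureReal_union_le _ _).trans (add_le_add (hloc' _) (hres k hk))
      _ = (coverIndices d).card * (p + q) := by rw [Finset.sum_const, nsmul_eq_mul]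
      _ ≤ _ := by
        gcongr
        exact card_coverIndices_le d
  rw [probReal_compl_eq_one_sub hgm] at hcompl
  linarith

/-- The dichotomy for good potentials: if `W` is not small near `a`, it decays in the annulus. -/
theorem W_le_on_annulus_of_good (hd : 1 ≤ d) {ν : ℝ} (hν : 0 ≤ ν) {ξ ζ : ℝ} {e : Exponents ξ ζ}
    {L : ℝ} (hLs : IsLargeScale d ν e L) {a : Zd d} {m E A : ℝ} (hA : 0 < A) {V : Zd d → ℝ}
    (hV : V ∈ goodPotentials e L a m E (radiusUp e.κ A L)) {lam : ℝ} (hlam : |lam - E| < A)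
    (hW : ∃ b ∈ box (L / 3) (toR a),
      Real.exp (-(1 / 4 * m * hI E (radiusUp e.κ A L) lam * L)) < W ν V lam a b)
    {y : Zd d} (hy : y ∈ annulus L a) :
    W ν V lam a y ≤ Real.exp (-(7 / 132 * m * hI E (radiusUp e.κ A L) lam * ‖y - a‖)) := by
  have hL0 : 0 < L := by linarith [hLs.three_le]
  obtain ⟨⟨hm, hmA, φ, θ, hφ⟩, hcover⟩ := hV
  obtain ⟨b, hb, hWb⟩ := hW
  obtain ⟨j, hj⟩ : ∃ j, |θ j - lam| < 1 / 2 * Real.exp (-L ^ e.β) := by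
    by_contra hc
    push Not at hc
    have h1 := mem_box.1 hb
    have h2 := W_le_of_localized_basis hd hν hLs hA hm hmA hφ hlam hc (q := L / 4) (a := a)
      (y := b) (by linarith) (by rw [sub_self, norm_zero]; linarith) (by linarith)
    refine absurd hWb (not_lt.2 (h2.trans (le_of_eq ?_)))
    congr 1
    ring
  obtain ⟨k, hk, hyk⟩ := exists_coverIndex_of_mem_annulus hL0 hy
  obtain ⟨⟨-, -, φ', θ', hφ'⟩, hres⟩ := hcover k hk
  have hgap : ∀ j', 1 / 2 * Real.exp (-L ^ e.β) ≤ |θ' j' - lam| := by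
    intro j'
    by_contra hc
    push Not at hc
    obtain ⟨x, hx⟩ := exists_one_le_card_mul_sq (hφ j).1.1
    refine hres ⟨x, φ j, θ j, φ' j', θ' j', (hφ j).1, (hφ' j').1, ?_, hx⟩
    have h1 := abs_sub_le (θ j) lam (θ' j')
    rw [abs_sub_comm lam] at h1
    linarith
  refine (W_le_of_localized_basis hd hν hLs hA hm hmA hφ' hlam hgap (q := L / 8) le_rfl
    (norm_coverCenter_sub_le hL0.le a hk) (by linarith)).trans (Real.exp_le_exp.2 ?_)
  have hm0 : 0 < m := (Real.rpow_pos_of_pos hL0 _).trans_le hm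
  have hmh : 0 ≤ m * hI E (radiusUp e.κ A L) lam := mul_nonneg hm0.le (hfun_nonneg _)
  have := mul_le_mul_of_nonneg_left hy.2 hmh
  linarith

theorem W_mul_W_le_of_good (hd : 1 ≤ d) {ν : ℝ} (hν : 0 ≤ ν) {ξ ζ : ℝ} {e : Exponents ξ ζ}
    {L : ℝ} (hLs : IsLargeScale d ν e L) {a : Zd d} {m E A : ℝ} (hA : 0 < A) {V : Zd d → ℝ}
    (hV : V ∈ goodPotentials e L a m E (radiusUp e.κ A L)) {lam : ℝ} (hlam : |lam - E| < A)
    {y : Zd d} (hy : y ∈ annulus L a) :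
    W ν V lam a a * W ν V lam a y ≤
      Real.exp (-(7 / 132 * m * hI E (radiusUp e.κ A L) lam * ‖y - a‖)) := by
  have hL3 := hLs.three_le
  have hL0 : 0 < L := by linarith
  by_cases hW : Real.exp (-(1 / 4 * m * hI E (radiusUp e.κ A L) lam * L)) < W ν V lam a a
  · have h1 := W_le_on_annulus_of_good hd hν hLs hA hV hlam ⟨a, mem_box.2 (by
      rw [sub_self, norm_zero]; positivity), hW⟩ hy
    have h2 : W ν V lam a a ≤ 1 := by
      refine (W_le_jap hν a a).trans (le_of_eq ?_)
      simp [jap]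
    calc _ ≤ 1 * W ν V lam a y := mul_le_mul_of_nonneg_right h2 (W_nonneg a y)
      _ ≤ _ := by rwa [one_mul]
  · push Not at hW
    have hm := hV.1.1
    have hm0 : 0 < m := (Real.rpow_pos_of_pos hL0 _).trans_le hm
    have hhL := rpow_neg_le_hI e.κ_pos hA (by linarith) hlam (L := L)
    set h := hI E (radiusUp e.κ A L) lam with hh
    have hmh : L ^ (-(e.κ + e.κ')) ≤ m * h := by
      rw [neg_add_rev, Real.rpow_add hL0]
      exact mul_le_mul hm hhL (by positivity) hm0.le
    have hmh0 : 0 < m * h := lt_of_lt_of_le (by positivity) hmh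
    have hgap := hLs.two_mul_rpow_le hmh
    have hτ : 0 ≤ L ^ e.τ := by positivity
    have hWy : W ν V lam a y ≤ Real.exp (2 * L ^ e.β) := by
      refine (W_le_jap hν a y).trans (le_trans ?_ (hLs.weight hd))
      exact Real.rpow_le_rpow (jap_pos _).le
        (jap_le_four_mul (by linarith) (by linarith [hy.2])) hν
    refine (mul_le_mul hW hWy (W_nonneg a y) (Real.exp_pos _).le).trans ?_
    rw [← Real.exp_add, Real.exp_le_exp]
    have h1 := mul_le_mul_of_nonneg_left hy.2 hmh0.le
    have h2 : m * h * (L / 56 - 1 - L ^ e.τ) ≤ m * h * (L / 8) :=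
      mul_le_mul_of_nonneg_left (by linarith) hmh0.le
    linarith

end Cover

end Anderson

theorem corollary1p5 (d : ℕ) (hd : 1 ≤ d) (ν : ℝ) (hν : (d : ℝ) / 2 < ν)
    (ξ ζ : ℝ) (e : Exponents ξ ζ) :
    -- the scale depends only on `d`, `ν` and the exponents
    ∃ Lmin : ℝ, ∀ μ : Measure ℝ, IsSingleSiteLaw μ →
    -- the constant depends only on these and on the single-site law
    ∃ C : ℝ, ∀ (Ω : Type*) [MeasurableSpace Ω] (P : Measure Ω) [IsProbabilityMeasure P]
      (ω : Zd d → Ω → ℝ), IsAndersonPotential P μ ω →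
    ∀ L₀ E A₀ m₀ Cd A m : ℝ, 1 < L₀ → 0 < A₀ → 0 < Cd →
      A = AInfty e L₀ A₀ → m = mInfty e Cd L₀ m₀ →
      MSAConclusions e P ω L₀ E A m →
    ∀ L : ℕ, Even L → Lmin ≤ L → L₀ ^ e.γ ≤ L → ∀ a : Zd d,
    ∃ Y : Set Ω,
      DependsOnlyOn ω (box (5 * L) (toR a)) Y ∧
      1 - C * Real.exp (-(L : ℝ) ^ ξ) ≤ P.real Y ∧
      ∀ s ∈ Y, ∀ lam ∈ Set.Ioo (E - A) (E + A),
        ((∃ b ∈ box (L / 3) (toR a),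
            Real.exp (-(1 / 4 * m * hI E (radiusUp e.κ A L) lam * L)) <
              W ν (fun x => ω x s) lam a b) →
          ∀ y ∈ annulus L a, W ν (fun x => ω x s) lam a y ≤
            Real.exp (-(7 / 132 * m * hI E (radiusUp e.κ A L) lam * ‖y - a‖))) ∧
        ∀ y ∈ annulus L a,
          W ν (fun x => ω x s) lam a a * W ν (fun x => ω x s) lam a y ≤
            Real.exp (-(7 / 132 * m * hI E (radiusUp e.κ A L) lam * ‖y - a‖)) := by
  obtain ⟨Lmin, hLmin⟩ := Filter.eventually_atTop.1 (eventually_isLargeScale d ν e)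
  have hν0 : 0 ≤ ν := le_trans (by positivity) hν.le
  refine ⟨Lmin, fun μ hμ => ?_⟩
  obtain ⟨C, hC, hwegner⟩ := exists_wegner_const d e hμ
  refine ⟨1 + 9 ^ d * (1 + C), ?_⟩
  intro Ω _ P _ ω hω L₀ E A₀ m₀ Cd A m _ _ _ _ _ hmsa L _ hL hL₀ a
  have hLs : IsLargeScale d ν e L := hLmin L hL
  have hL3 := hLs.three_le
  have hL0 : (0 : ℝ) < L := by linarith
  rcases le_or_gt A 0 with hA | hA
  · refine ⟨Set.univ, MeasurableSet.univ, ?_, fun s _ lam hlam => ?_⟩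
    · rw [probReal_univ]
      have : 0 ≤ (1 + 9 ^ d * (1 + C)) * Real.exp (-(L : ℝ) ^ ξ) := by positivity
      linarith
    · linarith [hlam.1, hlam.2]
  refine ⟨{s | (fun z => ω z s) ∈ goodPotentials e L a m E (radiusUp e.κ A L)},
    dependsOnlyOn_goodPotentials ω e hL0 a m E _, ?_, fun s hs lam hlam => ?_⟩
  · refine le_trans (le_of_eq ?_) (le_measureReal_goodPotentials P hω.1 e L a
      (Real.exp_pos _).le (by positivity) (hmsa.2.2 L hL₀)
      (q := C * Real.exp (-(L : ℝ) ^ ξ)) fun k hk => hwegner Ω P ω hω L (by linarith) hLs.wegner _ _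
        (disjoint_box_coverCenter hL0 a hk))
    ring
  · have hlam' : |lam - E| < A := abs_lt.2 ⟨by linarith [hlam.1], by linarith [hlam.2]⟩
    exact ⟨fun hW y hy => W_le_on_annulus_of_good hd hν0 hLs hA hs hlam' hW hy,
      fun y hy => W_mul_W_le_of_good hd hν0 hLs hA hs hlam' hy⟩
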